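/- All graphs are finite and simple, and classes of graphs are closed under isomorphism. For an $n$-vertex graph $G$, a set $X\subseteq V(G)$ is a balanced separator if each component of $G-X$ has at most $2n/3$ vertices; $s(G)$ is the minimum size of a balanced separator of $G$, and for a class $\mathcal G$ of graphs, $s_{\mathcal G}(n)=\max\{s(G):G\in\mathcal G,\ |V(G)|\le n\}$ (with value $0$ if there is no such $G$). For an integer $r\ge 0$, an $r$-shallow minor of $G$ is a graph obtained from a subgraph of $G$ by contracting pairwise vertex-disjoint subgraphs, each of radius at most $r$; $\nabla_r(G)$ is the maximum of $|E(H)|/|V(H)|$ over the $r$-shallow minors $H$ of $G$, and $\nabla_{\mathcal G}(r)=\sup\{\nabla_r(G):G\in\mathcal G\}\in[0,\infty]$. A class is hereditary if it is closed under induced subgraphs. For $0<\varepsilon\le 1$, let $b_\varepsilon\in[-\infty,\infty]$ denote the supremum of the real numbers $b$ for which every hereditary class $\mathcal G$ of graphs such that $s_{\mathcal G}(n)=\Theta(n^{1-\varepsilon})$ satisfies $\nabla_{\mathcal G}(r)=\Omega(r^b)$. For every real $\varepsilon$ with $0<\varepsilon\le 1$, $$b_\varepsilon\le \frac{1}{2\varepsilon}-\frac12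 .$$ Moreover, for $0<\varepsilon<1$ let $\mathcal G_3^\varepsilon$ be the class of all graphs isomorphic to an induced subgraph of a graph $G^\varepsilon$, where $G$ is a $3$-regular graph, $m=|V(G)|$, and $G^\varepsilon$ is obtained from $G$ by subdividing each edge $\lceil m^{\varepsilon/(1-\varepsilon)}\rceil$ times. Then $\mathcal G_3^\varepsilon$ is hereditary, $s_{\mathcal G_3^\varepsilon}(n)=\Theta(n^{1-\varepsilon})$, and $\nabla_{\mathcal G_3^\varepsilon}(r)=O\bigl(r^{\frac{1}{2\varepsilon}-\frac12}\bigr)$. -/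

import Mathlib

open Filter Asymptotics
open scoped ENNReal NNReal

/-- A finite simple graph. -/
structure FinGraph : Type 1 where
  V : Type
  [finite : Finite V]
  graph : SimpleGraph V

attribute [instance] FinGraph.finite

namespace FinGraph

/-- The number of vertices. -/
noncomputable def order (G : FinGraph) : ℕ := Nat.card G.V

/-- The density `|E(G)| / |V(G)|` (equal to `0` for the graph without vertices). -/
noncomputable def density (G : FinGraph) : ℝ≥0 :=
  (G.graph.edgeSet.ncard : ℝ≥0) / (G.order : ℝ≥0)

/-- `X` is a balanced separator of `G`: each component of `G - X` has at most `2|V(G)|/3`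
vertices. -/
def IsBalancedSeparator (G : FinGraph) (X : Set G.V) : Prop :=
  ∀ C : (G.graph.induce Xᶜ).ConnectedComponent, 3 * C.supp.ncard ≤ 2 * G.order

/-- `s(G)`, the minimum size of a balanced separator of `G`.
The set is not empty, since `X = V(G)` is a balanced separator. -/
noncomputable def sepNumber (G : FinGraph) : ℕ :=
  sInf {k | ∃ X : Set G.V, G.IsBalancedSeparator X ∧ X.ncard = k}

/-- `H` is an `r`-shallow minor of `G`: the vertices of `H` correspond to pairwise vertex-disjoint
subgraphs of `G` of radius at most `r` (in particular nonempty and connected), and every edge of `H`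
is witnessed by an edge of `G` between the corresponding subgraphs. Vertices of `G` outside these
subgraphs, and edges that are not needed, are deleted before contracting; a vertex that is not
contracted is a subgraph of radius `0`. -/
def IsShallowMinor (r : ℕ) (H G : FinGraph) : Prop :=
  ∃ B : H.V → G.graph.Subgraph,
    (∀ u, (B u).coe.radius ≤ (r : ℕ∞)) ∧
    (∀ u v, u ≠ v → Disjoint (B u).verts (B v).verts) ∧
    (∀ u v, H.graph.Adj u v → ∃ x ∈ (B u).verts, ∃ y ∈ (B v).verts, G.graph.Adj x y)

/-- `∇_r(G)`, the maximum density of an `r`-shallow minor of `G`. -/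
noncomputable def nabla (r : ℕ) (G : FinGraph) : ℝ≥0∞ :=
  ⨆ (H : FinGraph) (_ : IsShallowMinor r H G), (H.density : ℝ≥0∞)

/-- The `j`-th vertex, `0 ≤ j ≤ k + 1`, of the path that replaces the edge `e` when every edge is
subdivided `k` times: the `0`-th and the `(k+1)`-st one are the ends of `e` (in an arbitrary but fixed
order), and the other ones are the new vertices `(e, 0), …, (e, k - 1)`. -/
noncomputable def subdivVertex {V : Type} (G : SimpleGraph V) (k : ℕ) (e : G.edgeSet) (j : ℕ) :
    V ⊕ (G.edgeSet × Fin k) :=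
  if j = 0 then Sum.inl (Quot.out e.1).1
  else if h : j - 1 < k then Sum.inr (e, ⟨j - 1, h⟩)
  else Sum.inl (Quot.out e.1).2

/-- The graph obtained from `G` by subdividing each edge `k` times. -/
noncomputable def subdivide (G : FinGraph) (k : ℕ) : FinGraph where
  V := G.V ⊕ (G.graph.edgeSet × Fin k)
  graph := SimpleGraph.fromRel fun x y => ∃ e : G.graph.edgeSet, ∃ j ≤ k,
    x = subdivVertex G.graph k e j ∧ y = subdivVertex G.graph k e (j + 1)

/-- `G^ε`: each edge of `G` is subdivided `⌈m^{ε/(1-ε)}⌉` times, where `m = |V(G)|`. -/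
noncomputable def epsSubdivision (ε : ℝ) (G : FinGraph) : FinGraph :=
  G.subdivide ⌈(G.order : ℝ) ^ (ε / (1 - ε))⌉₊

/-- All vertices have degree three. -/
def IsCubic (G : FinGraph) : Prop := ∀ v : G.V, (G.graph.neighborSet v).ncard = 3

/-- `H` is isomorphic to an induced subgraph of `G`. -/
def IsInducedSubgraph (H G : FinGraph) : Prop := Nonempty (H.graph ↪g G.graph)

/-- A class of graphs is hereditary if it is closed under induced subgraphs (and, as usual, under
isomorphism). -/
def IsHereditary (𝒢 : Set FinGraph) : Prop :=
  ∀ G ∈ 𝒢, ∀ H : FinGraph, IsInducedSubgraph H G → H ∈ 𝒢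

/-- `s_𝒢(n) = max {s(G) : G ∈ 𝒢, |V(G)| ≤ n}`. The set is bounded by `n`. -/
noncomputable def classSep (𝒢 : Set FinGraph) (n : ℕ) : ℕ :=
  sSup {k | ∃ G ∈ 𝒢, G.order ≤ n ∧ G.sepNumber = k}

/-- `∇_𝒢(r) = sup {∇_r(G) : G ∈ 𝒢}`, possibly infinite. -/
noncomputable def classNabla (𝒢 : Set FinGraph) (r : ℕ) : ℝ≥0∞ :=
  ⨆ G ∈ 𝒢, nabla r G

/-- `s_𝒢(n) = Θ(n^a)` as `n → ∞`. -/
def SepIsTheta (𝒢 : Set FinGraph) (a : ℝ) : Prop :=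
  (fun n : ℕ => (classSep 𝒢 n : ℝ)) =Θ[atTop] fun n : ℕ => (n : ℝ) ^ a

/-- `∇_𝒢(r) = Ω(r^b)` as `r → ∞`. -/
def NablaIsOmega (𝒢 : Set FinGraph) (b : ℝ) : Prop :=
  ∃ c : ℝ, 0 < c ∧ ∀ᶠ r : ℕ in atTop, ENNReal.ofReal (c * (r : ℝ) ^ b) ≤ classNabla 𝒢 r

/-- `∇_𝒢(r) = O(r^b)` as `r → ∞`. -/
def NablaIsBigO (𝒢 : Set FinGraph) (b : ℝ) : Prop :=
  ∃ C : ℝ, ∀ᶠ r : ℕ in atTop, classNabla 𝒢 r ≤ ENNReal.ofReal (C * (r : ℝ) ^ b)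

/-- `b_ε`: the supremum, in the extended reals, of the real numbers `b` such that every hereditary
class `𝒢` with `s_𝒢(n) = Θ(n^{1-ε})` satisfies `∇_𝒢(r) = Ω(r^b)`. -/
noncomputable def bExponent (ε : ℝ) : EReal :=
  sSup {x | ∃ b : ℝ, x = (b : EReal) ∧
    ∀ 𝒢 : Set FinGraph, IsHereditary 𝒢 → SepIsTheta 𝒢 (1 - ε) → NablaIsOmega 𝒢 b}

/-- The class of all induced subgraphs of the graphs `G^ε` for the `3`-regular graphs `G`. -/
def cubicSubdivisionClass (ε : ℝ) : Set FinGraph :=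
  {H | ∃ G : FinGraph, G.IsCubic ∧ IsInducedSubgraph H (G.epsSubdivision ε)}

end FinGraph

/-!
Let `G` be a cubic graph with `m` vertices, and let `k` be the number of times each edge is subdivided.

*Upper bound on separators.* An induced subgraph `L` with `n` vertices contains at most `n / k` complete
subdivided edges. Once their ends are removed, no component contains two vertices of `G`, so two more
vertices suffice to balance what remains (`exists_sepNumber_le_of_induced`). At most `min m (2 * n / k)`
ends are removed, which for `k = ⌈m ^ (ε / (1 - ε))⌉` is at most `2 * n ^ (1 - ε)`.

*Lower bound on separators.* Subdividing the edges of a cubic graph at most halves the separation number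
(`IsCubic.sepNumber_le_two_mul`), and the subdivision has `O(m ^ (1 / (1 - ε)))` vertices; so cubic
graphs whose separation number is linear in `m` are enough. They come from a union bound: the
probability that twenty random permutations of `N` points all map a given set with a quarter of the
points into a given set with three quarters of the points is less than `4 ^ (-N)`, so some choice of
permutations does this for no pair of sets (`exists_expanding_perms`). Replacing each point with a cycle through forty ports, one for each
permutation and one for each inverse, makes the resulting Schreier graph cubic and simple
(`portGraph`).

*Shallow minors.* In an `r`-shallow minor, a contracted set without vertices of `G` is an interval of a
subdivided edge and contributes at most two edges. The remaining edges come from distinct edges of `G`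
with the left end in a contracted set (`IsShallowMinor.exists_ncard_edgeSet_le`). If `2 * r ≤ k`, then
a contracted set contains at most one vertex of `G`, and the density is bounded. Otherwise `m` is at most
`(2 * r) ^ ((1 - ε) / ε)`, and a graph with at most `3 * m` edges has density `O(√m)`.

The bound on `b_ε` follows for `ε < 1`, since this class satisfies the upper bound on `∇`. For `ε = 1`
the class of linear forests has bounded separators and bounded `∇`, by the same two lemmas.
-/

namespace FinGraph

/-! ### Subdivided edges as paths -/

/-- The end of `e` at position `0` of the path replacing `e`. -/
noncomputable def leftEnd {V : Type} (G : SimpleGraph V) (e : G.edgeSet) : V := (Quot.out e.1).1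

/-- The end of `e` at the last position of the path replacing `e`. -/
noncomputable def rightEnd {V : Type} (G : SimpleGraph V) (e : G.edgeSet) : V := (Quot.out e.1).2

section Path

variable {V : Type} {G : SimpleGraph V} {k : ℕ}

theorem mk_leftEnd_rightEnd (e : G.edgeSet) : s(leftEnd G e, rightEnd G e) = e.1 :=
  Quot.out_eq e.1

theorem adj_leftEnd_rightEnd (e : G.edgeSet) : G.Adj (leftEnd G e) (rightEnd G e) := by
  rw [← SimpleGraph.mem_edgeSet, mk_leftEnd_rightEnd]
  exact e.2

theorem leftEnd_or_rightEnd_of_mem {e : G.edgeSet} {v : V} (h : v ∈ e.1) :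
    v = leftEnd G e ∨ v = rightEnd G e := by
  rwa [← mk_leftEnd_rightEnd, Sym2.mem_iff] at h

@[simp] theorem subdivVertex_zero (e : G.edgeSet) :
    subdivVertex G k e 0 = Sum.inl (leftEnd G e) := by
  simp [subdivVertex, leftEnd]

@[simp] theorem subdivVertex_last (e : G.edgeSet) :
    subdivVertex G k e (k + 1) = Sum.inl (rightEnd G e) := by
  simp [subdivVertex, rightEnd]

theorem subdivVertex_of_pos {e : G.edgeSet} {j : ℕ} (h0 : 0 < j) (hk : j ≤ k) :
    subdivVertex G k e j = Sum.inr (e, ⟨j - 1, by omega⟩) := by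
  unfold subdivVertex
  rw [if_neg (by omega), dif_pos (by omega)]

theorem inr_eq_subdivVertex (e : G.edgeSet) (i : Fin k) :
    (Sum.inr (e, i) : V ⊕ (G.edgeSet × Fin k)) = subdivVertex G k e (i + 1) := by
  rw [subdivVertex_of_pos (by omega) (by omega)]
  simp

/-- Inner positions determine the edge and the position. -/
theorem eq_of_subdivVertex_eq {e f : G.edgeSet} {i j : ℕ} (hi0 : 0 < i) (hik : i ≤ k)
    (hj : j ≤ k + 1) (h : subdivVertex G k f j = subdivVertex G k e i) : f = e ∧ j = i := by
  rw [subdivVertex_of_pos hi0 hik] at h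
  rcases Nat.eq_zero_or_pos j with rfl | hj0
  · simp at h
  · rcases Nat.lt_or_ge k j with hjk | hjk
    · obtain rfl : j = k + 1 := by omega
      simp at h
    · rw [subdivVertex_of_pos hj0 hjk] at h
      simp only [Sum.inr.injEq, Prod.mk.injEq, Fin.mk.injEq] at h
      exact ⟨h.1, by omega⟩

theorem subdivVertex_ne_succ (e : G.edgeSet) {j : ℕ} (hj : j ≤ k) :
    subdivVertex G k e j ≠ subdivVertex G k e (j + 1) := by
  intro h
  rcases Nat.eq_zero_or_pos j with rfl | hj0
  · rcases Nat.eq_zero_or_pos k with rfl | hk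
    · have h1 := subdivVertex_last (k := 0) e
      rw [zero_add] at h1 h
      rw [subdivVertex_zero, h1, Sum.inl.injEq] at h
      exact (adj_leftEnd_rightEnd e).ne h
    · have := (eq_of_subdivVertex_eq (by omega) (by omega) (by omega) h).2
      omega
  · have := (eq_of_subdivVertex_eq hj0 hj (by omega) h.symm).2
    omega

end Path

theorem subdivide_adj_iff {G : FinGraph} {k : ℕ} {x y : G.V ⊕ (G.graph.edgeSet × Fin k)} :
    (G.subdivide k).graph.Adj x y ↔ ∃ e : G.graph.edgeSet, ∃ j ≤ k,
      (x = subdivVertex G.graph k e j ∧ y = subdivVertex G.graph k e (j + 1)) ∨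
      (y = subdivVertex G.graph k e j ∧ x = subdivVertex G.graph k e (j + 1)) := by
  change (SimpleGraph.fromRel _).Adj x y ↔ _
  rw [SimpleGraph.fromRel_adj]
  constructor
  · rintro ⟨-, ⟨e, j, hj, h⟩ | ⟨e, j, hj, h⟩⟩
    · exact ⟨e, j, hj, Or.inl h⟩
    · exact ⟨e, j, hj, Or.inr h⟩
  · rintro ⟨e, j, hj, ⟨rfl, rfl⟩ | ⟨rfl, rfl⟩⟩
    · exact ⟨subdivVertex_ne_succ e hj, Or.inl ⟨e, j, hj, rfl, rfl⟩⟩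
    · exact ⟨(subdivVertex_ne_succ e hj).symm, Or.inr ⟨e, j, hj, rfl, rfl⟩⟩

theorem subdivide_adj {G : FinGraph} {k : ℕ} (e : G.graph.edgeSet) {j : ℕ} (hj : j ≤ k) :
    (G.subdivide k).graph.Adj (subdivVertex G.graph k e j) (subdivVertex G.graph k e (j + 1)) :=
  subdivide_adj_iff.2 ⟨e, j, hj, Or.inl ⟨rfl, rfl⟩⟩

theorem order_subdivide (G : FinGraph) (k : ℕ) :
    (G.subdivide k).order = G.order + G.graph.edgeSet.ncard * k := by
  change Nat.card (G.V ⊕ (G.graph.edgeSet × Fin k)) = _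
  rw [Nat.card_sum, Nat.card_prod, Nat.card_fin]
  rfl

/-! ### Separators and components -/

/-- A function that agrees on adjacent vertices of a component is constant on it. -/
theorem eq_of_mem_supp {V : Type*} {α : Sort*} {G : SimpleGraph V} (C : G.ConnectedComponent)
    (f : V → α)
    (hf : ∀ x ∈ C.supp, ∀ y ∈ C.supp, G.Adj x y → f x = f y) {x y : V}
    (hx : x ∈ C.supp) (hy : y ∈ C.supp) : f x = f y := by
  obtain ⟨p⟩ := C.reachable_of_mem_supp hx hy
  induction p with
  | nil => rfl
  | cons h p ih =>
    have hv := C.mem_supp_of_adj_mem_supp hx h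
    exact (hf _ hx _ hv h).trans (ih hv hy)

theorem sepNumber_le {G : FinGraph} {X : Set G.V} (h : G.IsBalancedSeparator X) :
    G.sepNumber ≤ X.ncard := Nat.sInf_le ⟨X, h, rfl⟩

theorem isBalancedSeparator_univ (G : FinGraph) : G.IsBalancedSeparator Set.univ := by
  intro C
  obtain ⟨x, -⟩ := C.nonempty_supp
  exact absurd trivial x.2

theorem sepNumber_le_order (G : FinGraph) : G.sepNumber ≤ G.order := by
  have := sepNumber_le G.isBalancedSeparator_univ
  rwa [Set.ncard_univ] at this

theorem exists_isBalancedSeparator (G : FinGraph) :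
    ∃ X : Set G.V, G.IsBalancedSeparator X ∧ X.ncard = G.sepNumber :=
  Nat.sInf_mem (s := {k | ∃ X : Set G.V, G.IsBalancedSeparator X ∧ X.ncard = k})
    ⟨_, _, G.isBalancedSeparator_univ, rfl⟩

theorem le_classSep {𝒢 : Set FinGraph} {G : FinGraph} (hG : G ∈ 𝒢) {n : ℕ} (hn : G.order ≤ n) :
    G.sepNumber ≤ classSep 𝒢 n := by
  refine le_csSup ⟨n, ?_⟩ ⟨G, hG, hn, rfl⟩
  rintro _ ⟨H, -, hH, rfl⟩
  exact H.sepNumber_le_order.trans hH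

theorem classSep_le {𝒢 : Set FinGraph} {n b : ℕ}
    (h : ∀ G ∈ 𝒢, G.order ≤ n → G.sepNumber ≤ b) : classSep 𝒢 n ≤ b := by
  rcases Set.eq_empty_or_nonempty {k | ∃ G ∈ 𝒢, G.order ≤ n ∧ G.sepNumber = k} with he | hne
  · rw [classSep, he]
    simp
  · refine csSup_le hne ?_
    rintro _ ⟨H, hH, hn, rfl⟩
    exact h H hH hn

/-! ### Separators of induced subgraphs of subdivisions -/

/-- A point of `A` with at most half of `A` strictly on either side of it; `f` may have ties. -/
theorem exists_median {α : Type*} [Finite α] {A : Set α} (hA : A.Nonempty) (f : α → ℕ) :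
    ∃ x ∈ A, 2 * {y ∈ A | f y < f x}.ncard ≤ A.ncard ∧ 2 * {y ∈ A | f x < f y}.ncard ≤ A.ncard := by
  have key : ∀ z : α, {y ∈ A | f y ≤ f z}.ncard + {y ∈ A | f z < f y}.ncard = A.ncard := by
    intro z
    rw [← Set.ncard_union_eq]
    · congr 1
      ext y
      simp only [Set.mem_union, Set.mem_ofPred_eq]
      have := le_or_gt (f y) (f z)
      tauto
    · rw [Set.disjoint_left]
      rintro y ⟨-, h1⟩ ⟨-, h2⟩
      exact absurd h1 (not_le.2 h2)
  -- `x` has the least value among the points below or at which at least half of `A` lies.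
  let T : Set α := {x ∈ A | A.ncard ≤ 2 * {y ∈ A | f y ≤ f x}.ncard}
  have hT : T.Nonempty := by
    obtain ⟨x, hx, hmax⟩ := Set.exists_max_image A f A.toFinite hA
    refine ⟨x, hx, ?_⟩
    have : {y ∈ A | f y ≤ f x} = A := by
      ext y
      exact ⟨fun h => h.1, fun h => ⟨h, hmax y h⟩⟩
    rw [this]
    omega
  obtain ⟨x, ⟨hxA, hx⟩, hmin⟩ := Set.exists_min_image T f T.toFinite hT
  refine ⟨x, hxA, ?_, ?_⟩
  · by_contra! hlt
    have hne : {y ∈ A | f y < f x}.Nonempty := by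
      rw [← Set.ncard_pos]
      omega
    obtain ⟨z, ⟨hzA, hz⟩, hzmax⟩ := Set.exists_max_image _ f (Set.toFinite _) hne
    have hsub : {y ∈ A | f y < f x} = {y ∈ A | f y ≤ f z} := by
      ext y
      exact ⟨fun h => ⟨h.1, hzmax y h⟩, fun h => ⟨h.1, lt_of_le_of_lt h.2 hz⟩⟩
    rw [hsub] at hlt
    exact absurd (hmin z ⟨hzA, hlt.le⟩) (not_le.2 hz)
  · have := key x
    omega

/-- An induced subgraph of a subdivision contains some number `f` of complete subdivided edges. The
ends of these edges, together with at most two more vertices, form a balanced separator. -/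
theorem exists_sepNumber_le_of_induced {G L : FinGraph} {k : ℕ}
    (φ : L.graph ↪g (G.subdivide k).graph) :
    ∃ f : ℕ, f * k ≤ L.order ∧ L.sepNumber ≤ min G.order (2 * f) + 2 := by
  classical
  let φ' : L.V → G.V ⊕ (G.graph.edgeSet × Fin k) := φ
  have hφ : Function.Injective φ' := φ.injective
  let P : G.graph.edgeSet → ℕ → G.V ⊕ (G.graph.edgeSet × Fin k) := subdivVertex G.graph k
  let F : Set G.graph.edgeSet := {e | ∀ j ≤ k + 1, P e j ∈ Set.range φ'}
  have hp : ∀ e : G.graph.edgeSet, ∃ j, e ∉ F → j ≤ k + 1 ∧ P e j ∉ Set.range φ' := by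
    intro e
    by_cases he : e ∈ F
    · exact ⟨0, fun h => absurd he h⟩
    · obtain ⟨j, hj, h⟩ : ∃ j ≤ k + 1, P e j ∉ Set.range φ' := by
        simpa [F] using he
      exact ⟨j, fun _ => ⟨hj, h⟩⟩
  choose p hp using hp
  -- An edge that is not complete is cut at a missing position `p e`, and each of its two parts
  -- gets the end on its side as label.
  let lab : G.V ⊕ (G.graph.edgeSet × Fin k) → G.V ⊕ G.graph.edgeSet := Sum.elim Sum.inl fun x =>
    if x.1 ∈ F then Sum.inr x.1 else
      if (x.2 : ℕ) + 1 < p x.1 then Sum.inl (leftEnd G.graph x.1) else Sum.inl (rightEnd G.graph x.1)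
  have hlabF : ∀ e ∈ F, ∀ j, 0 < j → j ≤ k → lab (P e j) = Sum.inr e := by
    intro e he j h0 hk
    simp [lab, P, subdivVertex_of_pos h0 hk, he]
  have hlabl : ∀ e ∉ F, ∀ j < p e, lab (P e j) = Sum.inl (leftEnd G.graph e) := by
    intro e he j hj
    have := (hp e he).1
    rcases Nat.eq_zero_or_pos j with rfl | h0
    · simp [lab, P]
    · have h1 : j - 1 + 1 < p e := by omega
      simp [lab, P, subdivVertex_of_pos h0 (by omega : j ≤ k), he, h1]
  have hlabr : ∀ e ∉ F, ∀ j, p e < j → j ≤ k + 1 → lab (P e j) = Sum.inl (rightEnd G.graph e) := by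
    intro e he j hj hk
    rcases Nat.lt_or_ge k j with h | h
    · obtain rfl : j = k + 1 := by omega
      simp [lab, P]
    · have h1 : ¬ (j - 1 + 1 < p e) := by omega
      simp [lab, P, subdivVertex_of_pos (by omega : 0 < j) h, he, h1]
  let B : Set G.V := {v | ∃ e ∈ F, v ∈ e.1}
  let star : G.V → Set L.V := fun u => {x | lab (φ' x) = Sum.inl u}
  let seg : G.graph.edgeSet → Set L.V := fun e => {x | ∃ i, φ' x = Sum.inr (e, i)}
  let pos : L.V → ℕ := fun x => Sum.elim (fun _ => 0) (fun y => (y.2 : ℕ)) (φ' x)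
  have hmed : ∀ e : G.graph.edgeSet, ∃ x : Option L.V, 2 * L.order < 3 * (seg e).ncard →
      ∃ z ∈ seg e, x = some z ∧ 2 * {y ∈ seg e | pos y < pos z}.ncard ≤ (seg e).ncard ∧
        2 * {y ∈ seg e | pos z < pos y}.ncard ≤ (seg e).ncard := by
    intro e
    by_cases hb : 2 * L.order < 3 * (seg e).ncard
    · have hne : (seg e).Nonempty := by
        rw [← Set.ncard_pos]
        omega
      obtain ⟨z, hz, h⟩ := exists_median hne pos
      exact ⟨some z, fun _ => ⟨z, hz, rfl, h⟩⟩
    · exact ⟨none, fun h => absurd h hb⟩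
  choose med hmed using hmed
  let X₀ : Set L.V := {x | ∃ v ∈ B, φ' x = Sum.inl v}
  let X₁ : Set L.V := {x | ∃ u, 2 * L.order < 3 * (star u).ncard ∧ φ' x = Sum.inl u}
  let X₂ : Set L.V := {x | ∃ e, 2 * L.order < 3 * (seg e).ncard ∧ med e = some x}
  have hle : ∀ A : Set L.V, A.ncard ≤ L.order := fun A => Set.ncard_le_card A
  -- Two disjoint sets cannot both contain more than two thirds of the vertices.
  have hbig : ∀ A A' : Set L.V, 2 * L.order < 3 * A.ncard → 2 * L.order < 3 * A'.ncard →
      ∃ x, x ∈ A ∧ x ∈ A' := by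
    intro A A' h h'
    by_contra! hd
    have h1 := Set.ncard_union_eq (Set.disjoint_left.2 hd)
    have h2 := hle (A ∪ A')
    omega
  have hX₁ : X₁.ncard ≤ 1 := by
    rw [Set.ncard_le_one_iff]
    rintro x y ⟨u, hu, hxu⟩ ⟨v, hv, hyv⟩
    obtain ⟨w, h1, h2⟩ := hbig _ _ hu hv
    have : (Sum.inl u : G.V ⊕ G.graph.edgeSet) = Sum.inl v := h1.symm.trans h2
    rw [Sum.inl.injEq] at this
    exact hφ (by rw [hxu, hyv, this])
  have hX₂ : X₂.ncard ≤ 1 := by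
    rw [Set.ncard_le_one_iff]
    rintro x y ⟨e, he, hx⟩ ⟨e', he', hy⟩
    obtain ⟨w, ⟨i, hi⟩, ⟨i', hi'⟩⟩ := hbig _ _ he he'
    rw [hi, Sum.inr.injEq, Prod.mk.injEq] at hi'
    obtain rfl := hi'.1
    rw [hx, Option.some.injEq] at hy
    exact hy
  have hX₀B : X₀.ncard ≤ B.ncard := by
    have : (φ' '' X₀) ⊆ Sum.inl '' B := by
      rintro _ ⟨x, ⟨v, hv, hx⟩, rfl⟩
      exact ⟨v, hv, hx.symm⟩
    rw [← Set.ncard_image_of_injective X₀ hφ, ← Set.ncard_image_of_injective B Sum.inl_injective]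
    exact Set.ncard_le_ncard this
  have hBF : B.ncard ≤ 2 * F.ncard := by
    have : B ⊆ leftEnd G.graph '' F ∪ rightEnd G.graph '' F := by
      rintro v ⟨e, he, hv⟩
      rcases leftEnd_or_rightEnd_of_mem hv with rfl | rfl
      · exact Or.inl ⟨e, he, rfl⟩
      · exact Or.inr ⟨e, he, rfl⟩
    have h1 := Set.ncard_le_ncard this
    have h2 := Set.ncard_union_le (leftEnd G.graph '' F) (rightEnd G.graph '' F)
    have h3 := Set.ncard_image_le F.toFinite (f := leftEnd G.graph)
    have h4 := Set.ncard_image_le F.toFinite (f := rightEnd G.graph)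
    omega
  have hFk : F.ncard * k ≤ L.order := by
    have hsub : (Sum.inr '' (F ×ˢ (Set.univ : Set (Fin k))) :
        Set (G.V ⊕ (G.graph.edgeSet × Fin k))) ⊆ Set.range φ' := by
      rintro _ ⟨⟨e, i⟩, ⟨he, -⟩, rfl⟩
      rw [inr_eq_subdivVertex]
      exact he _ (by omega)
    have h1 := Set.ncard_le_ncard hsub
    rw [Set.ncard_image_of_injective _ Sum.inr_injective, Set.ncard_prod, Set.ncard_univ,
      Nat.card_fin, ← Set.image_univ, Set.ncard_image_of_injective _ hφ, Set.ncard_univ] at h1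
    exact h1
  refine ⟨F.ncard, hFk, ?_⟩
  suffices hsep : L.IsBalancedSeparator (X₀ ∪ X₁ ∪ X₂) by
    have h1 := sepNumber_le hsep
    have h2 := Set.ncard_union_le (X₀ ∪ X₁) X₂
    have h3 := Set.ncard_union_le X₀ X₁
    have h4 : B.ncard ≤ G.order := Set.ncard_le_card B
    have h5 : X₀.ncard ≤ min G.order (2 * F.ncard) :=
      le_min (hX₀B.trans h4) (hX₀B.trans hBF)
    omega
  intro C
  by_contra! hC
  have hCle : ∀ A : Set L.V, (∀ x ∈ C.supp, x.1 ∈ A) → C.supp.ncard ≤ A.ncard := by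
    intro A hA
    rw [← Set.ncard_image_of_injective C.supp Subtype.val_injective]
    refine Set.ncard_le_ncard ?_
    rintro _ ⟨x, hx, rfl⟩
    exact hA x hx
  have hadj : ∀ x y : ↥(X₀ ∪ X₁ ∪ X₂)ᶜ, (L.graph.induce (X₀ ∪ X₁ ∪ X₂)ᶜ).Adj x y →
      ∃ e : G.graph.edgeSet, ∃ j ≤ k, (φ' x.1 = P e j ∧ φ' y.1 = P e (j + 1)) ∨
        (φ' y.1 = P e j ∧ φ' x.1 = P e (j + 1)) := by
    intro x y h
    exact subdivide_adj_iff.1 (φ.map_rel_iff.2 h)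
  have hlab : ∀ x ∈ C.supp, ∀ y ∈ C.supp, lab (φ' x.1) = lab (φ' y.1) := by
    intro x hx y hy
    refine eq_of_mem_supp C (fun x => lab (φ' x.1)) ?_ hx hy
    have main : ∀ x y : ↥(X₀ ∪ X₁ ∪ X₂)ᶜ, ∀ e : G.graph.edgeSet, ∀ j ≤ k, φ' x.1 = P e j →
        φ' y.1 = P e (j + 1) → lab (φ' x.1) = lab (φ' y.1) := by
      intro x y e j hj hx hy
      rw [hx, hy]
      by_cases he : e ∈ F
      · have h0 : 0 < j := by
          by_contra! h0
          obtain rfl : j = 0 := by omega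
          refine x.2 (Or.inl (Or.inl ⟨leftEnd G.graph e, ⟨e, he, ?_⟩, ?_⟩))
          · rw [← mk_leftEnd_rightEnd]
            exact Sym2.mem_mk_left _ _
          · rw [hx]
            exact subdivVertex_zero e
        have h1 : j + 1 ≤ k := by
          by_contra! h1
          obtain rfl : j = k := by omega
          refine y.2 (Or.inl (Or.inl ⟨rightEnd G.graph e, ⟨e, he, ?_⟩, ?_⟩))
          · rw [← mk_leftEnd_rightEnd]
            exact Sym2.mem_mk_right _ _
          · rw [hy]
            exact subdivVertex_last e
        rw [hlabF e he j h0 hj, hlabF e he _ (by omega) h1]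
      · obtain ⟨-, hpe⟩ := hp e he
        have h1 : p e ≠ j := by
          rintro h
          exact hpe ⟨x.1, by rw [hx, h]⟩
        have h2 : p e ≠ j + 1 := by
          rintro h
          exact hpe ⟨y.1, by rw [hy, h]⟩
        rcases Nat.lt_or_ge j (p e) with h | h
        · rw [hlabl e he j h, hlabl e he (j + 1) (by omega)]
        · rw [hlabr e he j (by omega) (by omega), hlabr e he (j + 1) (by omega) (by omega)]
    intro x _ y _ h
    obtain ⟨e, j, hj, ⟨h1, h2⟩ | ⟨h1, h2⟩⟩ := hadj x y h
    · exact main x y e j hj h1 h2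
    · exact (main y x e j hj h1 h2).symm
  have hinl : ∀ x ∈ C.supp, ∀ u, φ' x.1 ≠ Sum.inl u := by
    intro x hx u hu
    have hs : C.supp.ncard ≤ (star u).ncard := hCle _ fun y hy => by
      change lab (φ' y.1) = Sum.inl u
      rw [hlab y hy x hx, hu]
      rfl
    exact x.2 (Or.inl (Or.inr ⟨u, by omega, hu⟩))
  -- Within `C`, all adjacencies join consecutive inner positions of one subdivided edge.
  have hadj' : ∀ x ∈ C.supp, ∀ y ∈ C.supp, (L.graph.induce (X₀ ∪ X₁ ∪ X₂)ᶜ).Adj x y →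
      ∃ e : G.graph.edgeSet, ∃ i i' : Fin k, φ' x.1 = Sum.inr (e, i) ∧ φ' y.1 = Sum.inr (e, i') ∧
        ((i' : ℕ) = i + 1 ∨ (i : ℕ) = i' + 1) := by
    have main : ∀ x ∈ C.supp, ∀ y ∈ C.supp, ∀ e : G.graph.edgeSet, ∀ j ≤ k, φ' x.1 = P e j →
        φ' y.1 = P e (j + 1) → ∃ i i' : Fin k, φ' x.1 = Sum.inr (e, i) ∧ φ' y.1 = Sum.inr (e, i') ∧
          ((i' : ℕ) = i + 1) := by
      intro x hx y hy e j hj h1 h2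
      have h0 : 0 < j := by
        by_contra! h0
        obtain rfl : j = 0 := by omega
        exact hinl x hx _ (h1.trans (subdivVertex_zero e))
      have h3 : j + 1 ≤ k := by
        by_contra! h3
        obtain rfl : j = k := by omega
        exact hinl y hy _ (h2.trans (subdivVertex_last e))
      exact ⟨_, _, h1.trans (subdivVertex_of_pos h0 hj),
        h2.trans (subdivVertex_of_pos (by omega) h3), by simp; omega⟩
    intro x hx y hy h
    obtain ⟨e, j, hj, ⟨h1, h2⟩ | ⟨h1, h2⟩⟩ := hadj x y h
    · obtain ⟨i, i', a, b, c⟩ := main x hx y hy e j hj h1 h2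
      exact ⟨e, i, i', a, b, Or.inl c⟩
    · obtain ⟨i, i', a, b, c⟩ := main y hy x hx e j hj h1 h2
      exact ⟨e, i', i, b, a, Or.inr c⟩
  obtain ⟨x₀, hx₀⟩ := C.nonempty_supp
  obtain ⟨e, i₀, hi₀⟩ : ∃ e i, φ' x₀.1 = Sum.inr (e, i) := by
    rcases h : φ' x₀.1 with u | ⟨e, i⟩
    · exact absurd h (hinl x₀ hx₀ u)
    · exact ⟨e, i, rfl⟩
  have hseg : ∀ x ∈ C.supp, x.1 ∈ seg e := by
    intro x hx
    have h := eq_of_mem_supp C (fun x => x.1 ∈ seg e) ?_ hx hx₀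
    · exact h.mpr ⟨i₀, hi₀⟩
    · intro x hx y hy hxy
      obtain ⟨e', i, i', h1, h2, -⟩ := hadj' x hx y hy hxy
      simp [seg, h1, h2]
  have hsege : C.supp.ncard ≤ (seg e).ncard := hCle _ hseg
  obtain ⟨z, ⟨iz, hiz⟩, hz, hz1, hz2⟩ := hmed e (by omega)
  have hzX : z ∈ X₂ := ⟨e, by omega, hz⟩
  have hposz : ∀ x ∈ C.supp, pos x.1 ≠ pos z := by
    intro x hx h
    obtain ⟨i, hi⟩ := hseg x hx
    have : i = iz := by
      simp only [pos, hi, hiz, Sum.elim_inr] at h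
      exact Fin.ext h
    refine x.2 (Or.inr ?_)
    rwa [hφ ((hi.trans (by rw [this])).trans hiz.symm)]
  have hside : ∀ x ∈ C.supp, (pos x.1 < pos z) = (pos x₀.1 < pos z) := by
    intro x hx
    refine eq_of_mem_supp C (fun x => pos x.1 < pos z) ?_ hx hx₀
    intro x hx y hy hxy
    obtain ⟨e', i, i', h1, h2, h3⟩ := hadj' x hx y hy hxy
    have hx' : pos x.1 = i := by simp [pos, h1]
    have hy' : pos y.1 = i' := by simp [pos, h2]
    have h4 := hposz x hx
    have h5 := hposz y hy
    apply propext
    show pos x.1 < pos z ↔ pos y.1 < pos z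
    omega
  have hn := hle (seg e)
  rcases Nat.lt_or_ge (pos x₀.1) (pos z) with h | h
  · have := hCle {y ∈ seg e | pos y < pos z} fun x hx => ⟨hseg x hx, (hside x hx).mpr h⟩
    omega
  · have := hCle {y ∈ seg e | pos z < pos y} fun x hx => ⟨hseg x hx, by
      have h1 := hposz x hx
      have h2 : ¬ pos x.1 < pos z := fun h' => absurd ((hside x hx).mp h') (not_lt.2 h)
      omega⟩
    omega

/-! ### Shallow minors of subdivisions -/

/-- The vertex sets that are contracted to form an `r`-shallow minor of an induced subgraph of `G`. -/
theorem IsShallowMinor.exists_bags {H L G : FinGraph} {r : ℕ} (h : IsShallowMinor r H L)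
    (φ : L.graph ↪g G.graph) :
    ∃ W : H.V → Set G.V, (∀ u, ∀ x ∈ W u, ∀ y ∈ W u, ∃ p : G.graph.Walk x y,
        (∀ z ∈ p.support, z ∈ W u) ∧ p.length ≤ 2 * r) ∧
      (∀ u v, u ≠ v → Disjoint (W u) (W v)) ∧
      (∀ u v, H.graph.Adj u v → ∃ x ∈ W u, ∃ y ∈ W v, G.graph.Adj x y) := by
  obtain ⟨B, hr, hd, ha⟩ := h
  refine ⟨fun u => φ '' (B u).verts, ?_, ?_, ?_⟩
  · rintro u _ ⟨x, hx, rfl⟩ _ ⟨y, hy, rfl⟩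
    have h1 : (B u).coe.edist ⟨x, hx⟩ ⟨y, hy⟩ ≤ ((2 * r : ℕ) : ℕ∞) := by
      refine SimpleGraph.edist_le_ediam.trans (SimpleGraph.ediam_le_two_mul_radius.trans ?_)
      push_cast
      exact mul_le_mul_right (hr u) 2
    obtain ⟨p, hp⟩ := SimpleGraph.exists_walk_of_edist_ne_top
      (ne_top_of_le_ne_top (ENat.natCast_ne_top _) h1)
    rw [← hp, Nat.cast_le] at h1
    let ψ : (B u).coe →g G.graph := φ.toHom.comp (B u).hom
    refine ⟨p.map ψ, ?_, (p.length_map ψ).trans_le h1⟩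
    intro z hz
    obtain ⟨w, -, rfl⟩ := List.mem_map.1 ((p.support_map ψ) ▸ hz)
    exact ⟨w.1, w.2, rfl⟩
  · intro u v huv
    exact (Set.disjoint_image_iff φ.injective).2 (hd u v huv)
  · intro u v huv
    obtain ⟨x, hx, y, hy, hxy⟩ := ha u v huv
    exact ⟨φ x, ⟨x, hx, rfl⟩, φ y, ⟨y, hy, rfl⟩, φ.map_rel_iff.2 hxy⟩

/-- A potential that increases by at most one along edges bounds lengths of walks from below. -/
theorem le_add_length {V : Type*} {G : SimpleGraph V} (f : V → ℕ)
    (hf : ∀ x y, G.Adj x y → f y ≤ f x + 1) {x y : V} (p : G.Walk x y) :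
    f y ≤ f x + p.length := by
  induction p with
  | nil => simp
  | cons h p ih =>
    have := hf _ _ h
    rw [SimpleGraph.Walk.length_cons]
    omega

/-- A property that passes along the edges into `W` passes along the walks within `W`. -/
theorem of_walk {V : Type*} {G : SimpleGraph V} {W : Set V} {Q : V → Prop}
    (hQ : ∀ x y, y ∈ W → G.Adj x y → Q x → Q y) {x y : V} (p : G.Walk x y)
    (hp : ∀ z ∈ p.support, z ∈ W) (hx : Q x) : Q y := by
  induction p with
  | nil => exact hx
  | cons h p ih =>
    refine ih (fun z hz => hp z (by simp [hz])) (hQ _ _ (hp _ (by simp)) h hx)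

/-- Distinct vertices of `G` have distance at least `k + 1` after subdividing each edge `k` times. -/
theorem lt_length_of_ne {G : FinGraph} {k : ℕ} {v w : G.V} (hvw : v ≠ w)
    (p : (G.subdivide k).graph.Walk (Sum.inl v) (Sum.inl w)) : k < p.length := by
  classical
  -- The distance from `v`, truncated at `k + 1`.
  let f : G.V ⊕ (G.graph.edgeSet × Fin k) → ℕ := Sum.elim (fun u => if u = v then 0 else k + 1)
    fun x => if leftEnd G.graph x.1 = v then x.2 + 1 else
      if rightEnd G.graph x.1 = v then k - x.2 else k + 1
  have hf : ∀ (e : G.graph.edgeSet), ∀ j ≤ k + 1, f (subdivVertex G.graph k e j) =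
      if leftEnd G.graph e = v then j else if rightEnd G.graph e = v then k + 1 - j else k + 1 := by
    intro e j hj
    have hne := (adj_leftEnd_rightEnd e).ne
    rcases Nat.eq_zero_or_pos j with rfl | h0
    · simp [f]
    · rcases Nat.lt_or_ge k j with h | h
      · obtain rfl : j = k + 1 := by omega
        by_cases h1 : leftEnd G.graph e = v
        · have h2 : rightEnd G.graph e ≠ v := fun h => hne (h1.trans h.symm)
          simp [f, h1, h2]
        · simp [f, h1]
      · have h1 : j - 1 + 1 = j := by omega
        have h2 : k - (j - 1) = k + 1 - j := by omega
        simp [f, subdivVertex_of_pos h0 h, h1, h2]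
  have hstep : ∀ e : G.graph.edgeSet, ∀ j ≤ k,
      f (subdivVertex G.graph k e (j + 1)) ≤ f (subdivVertex G.graph k e j) + 1 ∧
      f (subdivVertex G.graph k e j) ≤ f (subdivVertex G.graph k e (j + 1)) + 1 := by
    intro e j hj
    rw [hf e j (by omega), hf e (j + 1) (by omega)]
    split_ifs <;> omega
  have h1 := le_add_length f ?_ p
  · have hv : f (Sum.inl v) = 0 := if_pos rfl
    have hw : f (Sum.inl w) = k + 1 := if_neg hvw.symm
    rw [hv, hw, zero_add] at h1
    exact h1
  · intro x y h
    obtain ⟨e, j, hj, ⟨rfl, rfl⟩ | ⟨rfl, rfl⟩⟩ := subdivide_adj_iff.1 h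
    · exact (hstep e j hj).1
    · exact (hstep e j hj).2

/-- A connected set that meets a subdivided edge strictly between two positions outside the set
lies between these positions. -/
theorem eq_subdivVertex_of_mem {G : FinGraph} {k : ℕ} {W : Set (G.V ⊕ (G.graph.edgeSet × Fin k))}
    (hW : ∀ x ∈ W, ∀ y ∈ W, ∃ p : (G.subdivide k).graph.Walk x y, ∀ z ∈ p.support, z ∈ W)
    {e : G.graph.edgeSet} {p q q' : ℕ} (hq : q < p) (hq' : p < q') (hk : q' ≤ k + 1)
    (hp : subdivVertex G.graph k e p ∈ W) (hqW : subdivVertex G.graph k e q ∉ W)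
    (hqW' : subdivVertex G.graph k e q' ∉ W) {x : G.V ⊕ (G.graph.edgeSet × Fin k)} (hx : x ∈ W) :
    ∃ t, q < t ∧ t < q' ∧ x = subdivVertex G.graph k e t := by
  obtain ⟨w, hw⟩ := hW _ hp x hx
  refine of_walk (Q := fun a => ∃ t, q < t ∧ t < q' ∧ a = subdivVertex G.graph k e t) ?_ w hw
    ⟨p, hq, hq', rfl⟩
  rintro _ b hb h ⟨t, hqt, htq, rfl⟩
  obtain ⟨e', j, hj, ⟨h1, rfl⟩ | ⟨rfl, h1⟩⟩ := subdivide_adj_iff.1 h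
  · obtain ⟨rfl, rfl⟩ := eq_of_subdivVertex_eq (by omega) (by omega) (by omega) h1.symm
    refine ⟨j + 1, by omega, ?_, rfl⟩
    by_contra! hlt
    obtain rfl : q' = j + 1 := by omega
    exact hqW' hb
  · obtain ⟨rfl, rfl⟩ := eq_of_subdivVertex_eq (by omega) (by omega) (by omega) h1.symm
    refine ⟨j, ?_, by omega, rfl⟩
    by_contra! hlt
    obtain rfl : q = j := by omega
    exact hqW hb

theorem inl_ne_subdivVertex {V : Type} {G : SimpleGraph V} {k : ℕ} {e : G.edgeSet} {j : ℕ} {v : V}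
    (h0 : 0 < j) (hk : j ≤ k) : (Sum.inl v : V ⊕ (G.edgeSet × Fin k)) ≠ subdivVertex G k e j := by
  rw [subdivVertex_of_pos h0 hk]
  simp

theorem ncard_leftEnd_fiber_le {G : FinGraph} (v : G.V) :
    {e : G.graph.edgeSet | leftEnd G.graph e = v}.ncard ≤ (G.graph.neighborSet v).ncard := by
  refine Set.ncard_le_ncard_of_injOn (rightEnd G.graph) ?_ ?_
  · rintro e rfl
    exact adj_leftEnd_rightEnd e
  · intro e he e' he' h
    apply Subtype.ext
    rw [← mk_leftEnd_rightEnd e, ← mk_leftEnd_rightEnd e', h,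
      show leftEnd G.graph e = leftEnd G.graph e' from he.trans he'.symm]

/-- The edges of a shallow minor that come from a contracted set without vertices of `G` number at
most two per such set. The other ones come from distinct edges of `G`, whose left ends lie in the
contracted sets; `t` is the number of vertices of `G` in these sets. -/
theorem IsShallowMinor.exists_ncard_edgeSet_le {H L G : FinGraph} {r k : ℕ}
    (h : IsShallowMinor r H L) (φ : L.graph ↪g (G.subdivide k).graph)
    (hG : ∀ v, (G.graph.neighborSet v).ncard ≤ 3) :
    ∃ t : ℕ, H.graph.edgeSet.ncard ≤ 2 * H.order + 3 * t ∧ t ≤ G.order ∧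
      (2 * r ≤ k → t ≤ H.order) := by
  classical
  obtain ⟨W, hW, hdis, hadj⟩ := h.exists_bags φ
  change H.V → Set (G.V ⊕ (G.graph.edgeSet × Fin k)) at W
  have hW' : ∀ u, ∀ x ∈ W u, ∀ y ∈ W u,
      ∃ p : (G.subdivide k).graph.Walk x y, ∀ z ∈ p.support, z ∈ W u := by
    intro u x hx y hy
    obtain ⟨p, hp, -⟩ := hW u x hx y hy
    exact ⟨p, hp⟩
  have huniq : ∀ {u v x}, x ∈ W u → x ∈ W v → u = v := by
    intro u v x hu hv
    by_contra hne
    exact Set.disjoint_left.1 (hdis u v hne) hu hv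
  let P : G.graph.edgeSet → ℕ → G.V ⊕ (G.graph.edgeSet × Fin k) := subdivVertex G.graph k
  have hlink : ∀ d : H.graph.edgeSet, ∃ (l m : H.V) (e : G.graph.edgeSet) (j : ℕ),
      d.1 = s(l, m) ∧ l ≠ m ∧ j ≤ k ∧ P e j ∈ W l ∧ P e (j + 1) ∈ W m := by
    rintro ⟨d, hd⟩
    induction d with
    | h u v =>
      rw [SimpleGraph.mem_edgeSet] at hd
      obtain ⟨x, hx, y, hy, hxy⟩ := hadj u v hd
      obtain ⟨e, j, hj, ⟨rfl, rfl⟩ | ⟨rfl, rfl⟩⟩ := subdivide_adj_iff.1 hxy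
      · exact ⟨u, v, e, j, rfl, hd.ne, hj, hx, hy⟩
      · exact ⟨v, u, e, j, Sym2.eq_swap, hd.ne.symm, hj, hy, hx⟩
  choose lb rb ed ps hd hne hps hl hr using hlink
  have hl' : ∀ d, P (ed d) (ps d) ∉ W (rb d) := fun d h => hne d (huniq (hl d) h)
  have hr' : ∀ d, P (ed d) (ps d + 1) ∉ W (lb d) := fun d h => hne d (huniq h (hr d))
  have hext : ∀ d d', ed d = ed d' → ps d = ps d' → d = d' := by
    intro d d' he hp
    have h1 : lb d = lb d' := huniq (hl d) (by rw [he, hp]; exact hl d')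
    have h2 : rb d = rb d' := huniq (hr d) (by rw [he, hp]; exact hr d')
    apply Subtype.ext
    rw [hd, hd, h1, h2]
  let branch : Set H.V := {u | ∃ v : G.V, Sum.inl v ∈ W u}
  let R : Set H.graph.edgeSet := {d | rb d ∉ branch}
  let Lf : Set H.graph.edgeSet := {d | lb d ∉ branch}
  let M : Set H.graph.edgeSet := {d | lb d ∈ branch ∧ rb d ∈ branch}
  have hR : R.ncard ≤ H.order := by
    have hinj : Set.InjOn rb R := by
      have key : ∀ d ∈ R, ∀ d' ∈ R, rb d = rb d' → ed d = ed d' ∧ ps d ≤ ps d' := by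
        intro d hdR d' hdR' heq
        have hlast : P (ed d) (k + 1) ∉ W (rb d) := fun h =>
          hdR ⟨rightEnd G.graph (ed d), by rw [← subdivVertex_last (k := k)]; exact h⟩
        have hlt : ps d + 1 < k + 1 := by
          by_contra! hlt
          have h1 := hps d
          have : ps d = k := by omega
          exact hlast (this ▸ hr d)
        obtain ⟨t, h1, h2, h3⟩ := eq_subdivVertex_of_mem (hW' (rb d)) (by omega : ps d < ps d + 1)
          hlt le_rfl (hr d) (hl' d) hlast (heq ▸ hr d')
        have := hps d'
        obtain ⟨h4, h5⟩ := eq_of_subdivVertex_eq (by omega) (by omega) (by omega) h3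
        exact ⟨h4.symm, by omega⟩
      intro d hdR d' hdR' heq
      obtain ⟨h1, h2⟩ := key d hdR d' hdR' heq
      obtain ⟨-, h3⟩ := key d' hdR' d hdR heq.symm
      exact hext d d' h1 (le_antisymm h2 h3)
    exact (Set.ncard_le_ncard_of_injOn rb (fun _ _ => Set.mem_univ _) hinj).trans
      (Set.ncard_univ H.V).le
  have hL : Lf.ncard ≤ H.order := by
    have hinj : Set.InjOn lb Lf := by
      have key : ∀ d ∈ Lf, ∀ d' ∈ Lf, lb d = lb d' → ed d = ed d' ∧ ps d' ≤ ps d := by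
        intro d hdR d' hdR' heq
        have hfirst : P (ed d) 0 ∉ W (lb d) := fun h =>
          hdR ⟨leftEnd G.graph (ed d), by rw [← subdivVertex_zero (k := k)]; exact h⟩
        have hlt : 0 < ps d := by
          by_contra! hlt
          have : ps d = 0 := by omega
          exact hfirst (this ▸ hl d)
        have h0 := hps d
        obtain ⟨t, h1, h2, h3⟩ := eq_subdivVertex_of_mem (hW' (lb d)) hlt
          (by omega : ps d < ps d + 1) (by omega) (hl d) hfirst (hr' d) (heq ▸ hl d')
        have := hps d'
        obtain ⟨h4, h5⟩ := eq_of_subdivVertex_eq (by omega) (by omega) (by omega) h3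
        exact ⟨h4.symm, by omega⟩
      intro d hdR d' hdR' heq
      obtain ⟨h1, h2⟩ := key d hdR d' hdR' heq
      obtain ⟨-, h3⟩ := key d' hdR' d hdR heq.symm
      exact hext d d' h1 (le_antisymm h3 h2)
    exact (Set.ncard_le_ncard_of_injOn lb (fun _ _ => Set.mem_univ _) hinj).trans
      (Set.ncard_univ H.V).le
  let T : Set G.V := {v | ∃ u, Sum.inl v ∈ W u}
  have hMT : M.ncard ≤ 3 * T.ncard := by
    have hinj : Set.InjOn ed M := by
      have key : ∀ d ∈ M, ∀ d' ∈ M, ed d = ed d' → ps d' ≤ ps d := by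
        intro d hdM d' hdM' heq
        by_contra! hlt
        obtain ⟨v, hv⟩ := hdM.2
        have h0 := hps d'
        -- The right bag of `d` starts at `ps d + 1`, and cannot contain both ends of the link of
        -- `d'`; so it ends before a vertex of `G`.
        obtain ⟨q, hq1, hq2, hqW⟩ : ∃ q, ps d < q ∧ q ≤ k + 1 ∧ P (ed d) q ∉ W (rb d) := by
          by_cases h1 : P (ed d) (ps d') ∈ W (rb d)
          · refine ⟨ps d' + 1, by omega, by omega, fun h2 => ?_⟩
            rw [heq] at h1 h2
            exact hne d' ((huniq (hl d') h1).trans (huniq h2 (hr d')))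
          · exact ⟨ps d', hlt, by omega, h1⟩
        have hne' : ps d + 1 ≠ q := by
          rintro rfl
          exact hqW (hr d)
        obtain ⟨t, h1, h2, h3⟩ := eq_subdivVertex_of_mem (hW' (rb d)) (by omega : ps d < ps d + 1)
          (by omega) hq2 (hr d) (hl' d) hqW hv
        exact inl_ne_subdivVertex (by omega) (by omega) h3
      intro d hdM d' hdM' heq
      exact hext d d' heq (le_antisymm (key d' hdM' d hdM heq.symm) (key d hdM d' hdM' heq))
    have hleft : ∀ d ∈ M, leftEnd G.graph (ed d) ∈ T := by
      rintro d ⟨⟨v, hv⟩, -⟩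
      refine ⟨lb d, ?_⟩
      rw [← subdivVertex_zero (k := k)]
      by_contra h0
      have h1 := hps d
      have hpos : 0 < ps d := by
        by_contra! hlt
        have : ps d = 0 := by omega
        exact h0 (this ▸ hl d)
      obtain ⟨t, h2, h3, h4⟩ := eq_subdivVertex_of_mem (hW' (lb d)) hpos
          (by omega : ps d < ps d + 1) (by omega) (hl d) h0 (hr' d) hv
      exact inl_ne_subdivVertex (by omega) (by omega) h4
    have hfib : (ed '' M).ncard ≤ 3 * T.ncard := by
      have := Fintype.ofFinite G.V
      have := Fintype.ofFinite G.graph.edgeSet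
      rw [Set.ncard_eq_toFinset_card', Set.ncard_eq_toFinset_card' T]
      refine Finset.card_le_mul_card_image_of_maps_to (f := leftEnd G.graph) ?_ 3 ?_
      · intro e he
        obtain ⟨d, hdM, rfl⟩ := Set.mem_toFinset.1 he
        exact Set.mem_toFinset.2 (hleft d hdM)
      · intro v _
        refine le_trans ?_ ((ncard_leftEnd_fiber_le v).trans (hG v))
        rw [← Set.ncard_coe_finset]
        refine Set.ncard_le_ncard ?_
        intro e he
        exact (Finset.mem_filter.1 (Finset.mem_coe.1 he)).2
    rwa [hinj.ncard_image] at hfib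
  refine ⟨T.ncard, ?_, Set.ncard_le_card T, ?_⟩
  · have hcov : (Set.univ : Set H.graph.edgeSet) ⊆ R ∪ Lf ∪ M := by
      intro d _
      by_cases h1 : rb d ∈ branch
      · by_cases h2 : lb d ∈ branch
        · exact Or.inr ⟨h2, h1⟩
        · exact Or.inl (Or.inr h2)
      · exact Or.inl (Or.inl h1)
    have h1 := Set.ncard_le_ncard hcov
    rw [Set.ncard_univ, Nat.card_coe_set_eq] at h1
    have h2 := Set.ncard_union_le (R ∪ Lf) M
    have h3 := Set.ncard_union_le R Lf
    omega
  · intro hrk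
    have hT : ∀ v : G.V, ∃ u : Option H.V, v ∈ T → ∃ u', u = some u' ∧ Sum.inl v ∈ W u' := by
      intro v
      by_cases hv : v ∈ T
      · obtain ⟨u, hu⟩ := hv
        exact ⟨some u, fun _ => ⟨u, rfl, hu⟩⟩
      · exact ⟨none, fun h => absurd h hv⟩
    choose bag hbag using hT
    have := Set.ncard_le_ncard_of_injOn (s := T) (t := Set.range some) bag ?_ ?_
    · rwa [← Set.image_univ, Set.ncard_image_of_injective _ (Option.some_injective _),
        Set.ncard_univ] at this
    · intro v hv
      obtain ⟨u, hu, -⟩ := hbag v hv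
      exact ⟨u, hu.symm⟩
    · intro v hv w hw heq
      obtain ⟨u, hu, hvu⟩ := hbag v hv
      obtain ⟨u', hu', hwu'⟩ := hbag w hw
      obtain rfl : u = u' := by
        rw [hu, hu', Option.some.injEq] at heq
        exact heq
      by_contra hvw
      obtain ⟨p, -, hp⟩ := hW u _ hvu _ hwu'
      have := lt_length_of_ne hvw p
      omega

theorem ncard_edgeSet_le_order_sq (H : FinGraph) : H.graph.edgeSet.ncard ≤ H.order ^ 2 := by
  have hsub : H.graph.edgeSet ⊆ (fun p : H.V × H.V => s(p.1, p.2)) '' Set.univ := by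
    intro e _
    induction e with
    | h u v => exact ⟨(u, v), trivial, rfl⟩
  refine (Set.ncard_le_ncard hsub).trans ((Set.ncard_image_le (Set.toFinite _)).trans ?_)
  rw [Set.ncard_univ, Nat.card_prod, sq]
  rfl

theorem nabla_le_of_forall {G : FinGraph} {r : ℕ} {c : ℝ}
    (h : ∀ H, IsShallowMinor r H G → (H.graph.edgeSet.ncard : ℝ) ≤ c * H.order) (hc : 0 ≤ c) :
    nabla r G ≤ ENNReal.ofReal c := by
  refine iSup₂_le fun H hH => ?_
  rw [ENNReal.ofReal, ENNReal.coe_le_coe]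
  refine NNReal.le_toNNReal_of_coe_le ?_
  rw [density, NNReal.coe_div, NNReal.coe_natCast, NNReal.coe_natCast]
  exact div_le_of_le_mul₀ (Nat.cast_nonneg _) hc (h H hH)

/-- The density of a shallow minor is at most of the order of the square root of `|G|`, regardless of
the depth and of the number of subdivisions. -/
theorem nabla_le_of_subdivide {G L : FinGraph} {k : ℕ} (φ : L.graph ↪g (G.subdivide k).graph)
    (hG : ∀ v, (G.graph.neighborSet v).ncard ≤ 3) (r : ℕ) :
    nabla r L ≤ ENNReal.ofReal (5 + 2 * √(G.order : ℝ)) := by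
  refine nabla_le_of_forall (fun H hH => ?_) (by positivity)
  obtain ⟨t, h1, h2, -⟩ := hH.exists_ncard_edgeSet_le φ hG
  have h3 : (H.graph.edgeSet.ncard : ℝ) ≤ 2 * H.order + 3 * t := by exact_mod_cast h1
  have h4 : (t : ℝ) ≤ G.order := by exact_mod_cast h2
  have h5 : (H.graph.edgeSet.ncard : ℝ) ≤ (H.order : ℝ) ^ 2 := by
    exact_mod_cast H.ncard_edgeSet_le_order_sq
  have hs := Real.sq_sqrt (Nat.cast_nonneg (α := ℝ) G.order)
  have hs0 := Real.sqrt_nonneg (G.order : ℝ)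
  have hh : (0 : ℝ) ≤ H.order := Nat.cast_nonneg _
  -- With at most `2 * √|G|` vertices, a graph has small density by the trivial bound on its number
  -- of edges; with more of them, the at most `3 * |G|` edges counted by `t` are few per vertex.
  rcases le_total (H.order : ℝ) (2 * √(G.order : ℝ)) with h | h
  · nlinarith
  · nlinarith [mul_le_mul_of_nonneg_left h hs0]

/-- If the subdivided edges are long, no contracted set contains two vertices of `G`, and the density
is bounded. -/
theorem nabla_le_of_subdivide_of_le {G L : FinGraph} {k : ℕ}
    (φ : L.graph ↪g (G.subdivide k).graph) (hG : ∀ v, (G.graph.neighborSet v).ncard ≤ 3) {r : ℕ}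
    (hr : 2 * r ≤ k) : nabla r L ≤ ENNReal.ofReal 5 := by
  refine nabla_le_of_forall (fun H hH => ?_) (by norm_num)
  obtain ⟨t, h1, -, h2⟩ := hH.exists_ncard_edgeSet_le φ hG
  have := h2 hr
  have h3 : H.graph.edgeSet.ncard ≤ 5 * H.order := by omega
  exact_mod_cast h3

/-! ### Separators of subdivided cubic graphs -/

namespace IsCubic

theorem two_mul_ncard_edgeSet {G : FinGraph} (hG : G.IsCubic) :
    2 * G.graph.edgeSet.ncard = 3 * G.order := by
  classical
  have := Fintype.ofFinite G.V
  have h := G.graph.sum_degrees_eq_twice_card_edges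
  have hdeg : ∀ v, G.graph.degree v = 3 := by
    intro v
    rw [← hG v, Set.ncard_eq_toFinset_card']
    rfl
  rw [Finset.sum_congr rfl fun v _ => hdeg v, Finset.sum_const, smul_eq_mul, Finset.card_univ,
    ← Nat.card_eq_fintype_card] at h
  rw [Set.ncard_eq_toFinset_card']
  rw [order, mul_comm 3, h]
  rfl

theorem three_mul_ncard_le {G : FinGraph} (hG : G.IsCubic) (Z : Set G.V) :
    3 * Z.ncard ≤ 2 * {e : G.graph.edgeSet | ∃ v ∈ Z, v ∈ e.1}.ncard := by
  classical
  have := Fintype.ofFinite G.V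
  have := Fintype.ofFinite G.graph.edgeSet
  rw [Set.ncard_eq_toFinset_card', Set.ncard_eq_toFinset_card', mul_comm, mul_comm 2]
  refine Finset.card_mul_le_card_mul (fun v (e : G.graph.edgeSet) => v ∈ e.1) ?_ ?_
  · intro v hv
    let t := {e : G.graph.edgeSet | ∃ v ∈ Z, v ∈ e.1}.toFinset.bipartiteAbove
      (fun v (e : G.graph.edgeSet) => v ∈ e.1) v
    let f : G.graph.neighborSet v → t := fun w => ⟨⟨s(v, w.1), w.2⟩, by
      rw [Finset.mem_bipartiteAbove, Set.mem_toFinset]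
      exact ⟨⟨v, Set.mem_toFinset.1 hv, Sym2.mem_mk_left _ _⟩, Sym2.mem_mk_left _ _⟩⟩
    have hf : Function.Injective f := by
      intro w w' h
      have h' : s(v, w.1) = s(v, w'.1) := congrArg (fun e : t => e.1.1) h
      exact Subtype.ext (Sym2.congr_right.1 h')
    have h := Nat.card_le_card_of_injective f hf
    rwa [Nat.card_coe_set_eq, hG v, Nat.card_eq_fintype_card, Fintype.card_coe] at h
  · intro e _
    have hsub : Z.toFinset.bipartiteBelow (fun v (e : G.graph.edgeSet) => v ∈ e.1) e ⊆
        {leftEnd G.graph e, rightEnd G.graph e} := by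
      intro v hv
      rw [Finset.mem_bipartiteBelow] at hv
      simpa using leftEnd_or_rightEnd_of_mem hv.2
    exact (Finset.card_le_card hsub).trans Finset.card_le_two

/-- Subdividing the edges of a cubic graph at most halves the separation number: a balanced
separator of the subdivision becomes one of `G` if every subdividing vertex in it is replaced by the
two ends of its edge. A component of what remains has the same share of the vertices of `G` as the
corresponding component has, at least, of the vertices of the subdivision. -/
theorem sepNumber_le_two_mul {G : FinGraph} (hG : G.IsCubic) (k : ℕ) :
    G.sepNumber ≤ 2 * (G.subdivide k).sepNumber := by
  obtain ⟨X, hX, hXs⟩ := exists_isBalancedSeparator (G.subdivide k)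
  rw [← hXs]
  change Set (G.V ⊕ (G.graph.edgeSet × Fin k)) at X
  let P : G.graph.edgeSet → ℕ → G.V ⊕ (G.graph.edgeSet × Fin k) := subdivVertex G.graph k
  let Y : Set G.V := {v | Sum.inl v ∈ X ∨ ∃ e : G.graph.edgeSet, ∃ i, v ∈ e.1 ∧ Sum.inr (e, i) ∈ X}
  have hYX : Y.ncard ≤ 2 * X.ncard := by
    let g₁ : G.V ⊕ (G.graph.edgeSet × Fin k) → G.V := Sum.elim id fun x => leftEnd G.graph x.1
    let g₂ : G.V ⊕ (G.graph.edgeSet × Fin k) → G.V := Sum.elim id fun x => rightEnd G.graph x.1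
    have hsub : Y ⊆ g₁ '' X ∪ g₂ '' X := by
      rintro v (hv | ⟨e, i, hv, hi⟩)
      · exact Or.inl ⟨_, hv, rfl⟩
      · rcases leftEnd_or_rightEnd_of_mem hv with rfl | rfl
        · exact Or.inl ⟨_, hi, rfl⟩
        · exact Or.inr ⟨_, hi, rfl⟩
    have h1 := Set.ncard_le_ncard hsub
    have h2 := Set.ncard_union_le (g₁ '' X) (g₂ '' X)
    have h3 := Set.ncard_image_le X.toFinite (f := g₁)
    have h4 := Set.ncard_image_le X.toFinite (f := g₂)
    omega
  refine le_trans (sepNumber_le ?_) hYX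
  intro C
  have hYinl : ∀ v ∉ Y, (Sum.inl v : G.V ⊕ (G.graph.edgeSet × Fin k)) ∉ X :=
    fun v hv h => hv (Or.inl h)
  obtain ⟨x₀, hx₀⟩ := C.nonempty_supp
  let C' := ((G.subdivide k).graph.induce Xᶜ).connectedComponentMk ⟨Sum.inl x₀.1, hYinl _ x₀.2⟩
  let D : Set (G.V ⊕ (G.graph.edgeSet × Fin k)) := Subtype.val '' C'.supp
  have hD : D.ncard = C'.supp.ncard := Set.ncard_image_of_injective _ Subtype.val_injective
  have hDadj : ∀ x ∈ D, ∀ y ∉ X, (G.subdivide k).graph.Adj x y → y ∈ D := by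
    rintro _ ⟨x, hx, rfl⟩ y hy h
    exact ⟨⟨y, hy⟩, C'.mem_supp_of_adj_mem_supp hx h, rfl⟩
  have hinner : ∀ e : G.graph.edgeSet, ∀ v ∈ e.1, v ∉ Y → ∀ j, 0 < j → j ≤ k → P e j ∉ X := by
    intro e v hve hv j h0 hk hX
    refine hv (Or.inr ⟨e, ⟨j - 1, by omega⟩, hve, ?_⟩)
    rwa [← subdivVertex_of_pos h0 hk]
  have hleft : ∀ e : G.graph.edgeSet, leftEnd G.graph e ∉ Y → Sum.inl (leftEnd G.graph e) ∈ D →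
      ∀ j ≤ k + 1, (j = k + 1 → rightEnd G.graph e ∉ Y) → P e j ∈ D := by
    intro e he heD j
    induction j with
    | zero =>
      intro _ _
      rw [← subdivVertex_zero (k := k)] at heD
      exact heD
    | succ j ih =>
      intro hj hlast
      refine hDadj _ (ih (by omega) (by omega)) _ ?_ (subdivide_adj e (by omega))
      rcases Nat.lt_or_ge j k with h | h
      · refine hinner e _ ?_ he _ (by omega) (by omega)
        rw [← mk_leftEnd_rightEnd]
        exact Sym2.mem_mk_left _ _
      · obtain rfl : j = k := by omega
        change subdivVertex G.graph j e (j + 1) ∉ X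
        rw [subdivVertex_last]
        exact hYinl _ (hlast rfl)
  have hright : ∀ e : G.graph.edgeSet, rightEnd G.graph e ∉ Y → Sum.inl (rightEnd G.graph e) ∈ D →
      ∀ j ≤ k + 1, (j = k + 1 → leftEnd G.graph e ∉ Y) → P e (k + 1 - j) ∈ D := by
    intro e he heD j
    induction j with
    | zero =>
      intro _ _
      rw [← subdivVertex_last (k := k)] at heD
      exact heD
    | succ j ih =>
      intro hj hlast
      have hadj := subdivide_adj (k := k) e (show k + 1 - (j + 1) ≤ k by omega)
      rw [show k + 1 - (j + 1) + 1 = k + 1 - j by omega] at hadj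
      refine hDadj _ (ih (by omega) (by omega)) _ ?_ hadj.symm
      rcases Nat.lt_or_ge j k with h | h
      · refine hinner e _ ?_ he _ (by omega) (by omega)
        rw [← mk_leftEnd_rightEnd]
        exact Sym2.mem_mk_right _ _
      · obtain rfl : j = k := by omega
        rw [Nat.sub_self]
        change subdivVertex G.graph j e 0 ∉ X
        rw [subdivVertex_zero]
        exact hYinl _ (hlast rfl)
  have hedge : ∀ e : G.graph.edgeSet, ∀ v ∈ e.1, v ∉ Y → Sum.inl v ∈ D →
      ∀ i, Sum.inr (e, i) ∈ D := by
    intro e v hve hv hvD i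
    rw [inr_eq_subdivVertex]
    rcases leftEnd_or_rightEnd_of_mem hve with rfl | rfl
    · exact hleft e hv hvD _ (by omega) (by omega)
    · have := hright e hv hvD (k - i) (by omega) (by omega)
      rwa [show k + 1 - (k - i) = i + 1 by omega] at this
  have hstep : ∀ v w, G.graph.Adj v w → v ∉ Y → w ∉ Y → Sum.inl v ∈ D → Sum.inl w ∈ D := by
    intro v w hvw hv hw hvD
    let e : G.graph.edgeSet := ⟨s(v, w), hvw⟩
    have he : s(leftEnd G.graph e, rightEnd G.graph e) = s(v, w) := mk_leftEnd_rightEnd e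
    rw [Sym2.eq_iff] at he
    rcases he with ⟨h1, h2⟩ | ⟨h1, h2⟩
    · have := hleft e (h1 ▸ hv) (h1 ▸ hvD) (k + 1) le_rfl fun _ => h2 ▸ hw
      simp only [P, subdivVertex_last, h2] at this
      exact this
    · have := hright e (h2 ▸ hv) (h2 ▸ hvD) (k + 1) le_rfl fun _ => h1 ▸ hw
      simp only [P, Nat.sub_self, subdivVertex_zero, h1] at this
      exact this
  let Z : Set G.V := Subtype.val '' C.supp
  have hZD : ∀ v ∈ Z, Sum.inl v ∈ D := by
    rintro _ ⟨v, hv, rfl⟩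
    have h := eq_of_mem_supp C (fun x => (Sum.inl x.1 ∈ D : Prop)) ?_ hv hx₀
    · exact h.mpr ⟨_, rfl, rfl⟩
    · intro x _ y _ hxy
      have hxy' : G.graph.Adj x.1 y.1 := hxy
      exact propext ⟨hstep _ _ hxy' x.2 y.2, hstep _ _ hxy'.symm y.2 x.2⟩
  have hZY : ∀ v ∈ Z, v ∉ Y := by
    rintro _ ⟨v, hv, rfl⟩
    exact v.2
  let I : Set G.graph.edgeSet := {e | ∃ v ∈ Z, v ∈ e.1}
  have hcount : Z.ncard + I.ncard * k ≤ D.ncard := by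
    have hsub : Sum.inl '' Z ∪ Sum.inr '' (I ×ˢ (Set.univ : Set (Fin k))) ⊆ D := by
      rintro _ (⟨v, hv, rfl⟩ | ⟨⟨e, i⟩, ⟨⟨v, hv, hve⟩, -⟩, rfl⟩)
      · exact hZD v hv
      · exact hedge e v hve (hZY v hv) (hZD v hv) i
    have h := Set.ncard_le_ncard hsub
    rwa [Set.ncard_union_eq, Set.ncard_image_of_injective _ Sum.inl_injective,
      Set.ncard_image_of_injective _ Sum.inr_injective, Set.ncard_prod, Set.ncard_univ,
      Nat.card_fin] at h
    rw [Set.disjoint_left]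
    rintro _ ⟨v, -, rfl⟩ ⟨x, -, hx⟩
    cases hx
  have h1 : 3 * C'.supp.ncard ≤ 2 * (G.subdivide k).order := hX C'
  rw [order_subdivide, ← hD] at h1
  have h2 : 3 * Z.ncard ≤ 2 * I.ncard := hG.three_mul_ncard_le Z
  have h3 := hG.two_mul_ncard_edgeSet
  rw [← Set.ncard_image_of_injective C.supp Subtype.val_injective]
  change 3 * Z.ncard ≤ 2 * G.order
  refine Nat.le_of_mul_le_mul_left ?_ (show 0 < 2 + 3 * k by omega)
  have h4 := Nat.mul_le_mul_right k h2
  have h5 : 2 * G.graph.edgeSet.ncard * k = 3 * G.order * k := by rw [h3]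
  nlinarith

end IsCubic

/-! ### Cubic graphs with linear separators -/

open scoped Nat in
theorem card_perm_mapsTo_le {N : ℕ} (A Y : Finset (Fin N)) :
    (Finset.univ.filter fun π : Equiv.Perm (Fin N) => ∀ x ∈ A, π x ∈ Y).card ≤
      (N - A.card)! * Y.card.descFactorial A.card := by
  classical
  let S := {π : Equiv.Perm (Fin N) // ∀ x ∈ A, π x ∈ Y}
  let ρ : S → (A ↪ Y) := fun π => ⟨fun x => ⟨π.1 x, π.2 x x.2⟩, fun x y h =>
    Subtype.ext (π.1.injective (congrArg Subtype.val h))⟩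
  have h := Finset.card_le_mul_card_image_of_maps_to (s := (Finset.univ : Finset S))
    (t := Finset.univ) (f := ρ) (fun _ _ => Finset.mem_univ _) (N - A.card)! ?_
  · rwa [Finset.card_univ, Finset.card_univ, Fintype.card_embedding_eq, Fintype.card_coe,
      Fintype.card_coe, Fintype.card_subtype] at h
  · intro g _
    rcases Finset.eq_empty_or_nonempty (Finset.univ.filter fun π : S => ρ π = g) with he | ⟨π₀, h₀⟩
    · rw [he]
      simp
    -- Two permutations with the same restriction to `A` differ by a permutation fixing `A`.
    have hfix : ∀ π : S, ρ π = g → ∀ x, ¬ x ∉ A → (π₀.1⁻¹ * π.1) x = x := by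
      intro π hπ x hx
      have h1 : ρ π = ρ π₀ := hπ.trans (Finset.mem_filter.1 h₀).2.symm
      have h2 : π.1 x = π₀.1 x :=
        congrArg (fun f : A ↪ Y => (f ⟨x, not_not.1 hx⟩ : Fin N)) h1
      rw [Equiv.Perm.mul_apply, h2]
      exact π₀.1.symm_apply_apply x
    let F := {σ : Equiv.Perm (Fin N) // ∀ x, ¬ x ∉ A → σ x = x}
    have hF : Fintype.card F = (N - A.card)! := by
      rw [← Fintype.card_congr (Equiv.Perm.subtypeEquivSubtypePerm (fun x : Fin N => x ∉ A)),
        Fintype.card_perm, Fintype.card_subtype_compl, Fintype.card_fin, Fintype.card_coe]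
    rw [← hF, ← Finset.card_univ]
    refine Finset.card_le_card_of_injOn
      (fun π => if h : ρ π = g then ⟨π₀.1⁻¹ * π.1, hfix π h⟩ else ⟨1, fun _ _ => rfl⟩)
      (fun _ _ => Finset.mem_coe.2 (Finset.mem_univ _)) ?_
    intro π hπ π' hπ' heq
    have h1 := (Finset.mem_filter.1 (Finset.mem_coe.1 hπ)).2
    have h2 := (Finset.mem_filter.1 (Finset.mem_coe.1 hπ')).2
    simp only [h1, h2, dif_pos] at heq
    exact Subtype.ext (mul_left_cancel (congrArg Subtype.val heq))

theorem descFactorial_mul_pow_le {y N : ℕ} (h : y ≤ N) (a : ℕ) :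
    y.descFactorial a * N ^ a ≤ y ^ a * N.descFactorial a := by
  induction a with
  | zero => simp
  | succ a ih =>
    have h1 : (y - a) * N ≤ y * (N - a) := by
      rw [Nat.sub_mul, Nat.mul_sub, Nat.mul_comm y a]
      exact Nat.sub_le_sub_left (Nat.mul_le_mul_left a h) _
    calc y.descFactorial (a + 1) * N ^ (a + 1)
        = ((y - a) * N) * (y.descFactorial a * N ^ a) := by
          rw [Nat.descFactorial_succ]
          ring
      _ ≤ (y * (N - a)) * (y ^ a * N.descFactorial a) := Nat.mul_le_mul h1 ih
      _ = y ^ (a + 1) * N.descFactorial (a + 1) := by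
          rw [Nat.descFactorial_succ]
          ring

open scoped Nat in
/-- A random permutation maps `A` into a set with at most three quarters of the points with
probability at most `(3 / 4) ^ |A|`. -/
theorem card_perm_mapsTo_le_pow {N : ℕ} (hN : 0 < N) {A Y : Finset (Fin N)}
    (hY : 4 * Y.card ≤ 3 * N) :
    ((Finset.univ.filter fun π : Equiv.Perm (Fin N) => ∀ x ∈ A, π x ∈ Y).card : ℝ) ≤
      (3 / 4) ^ A.card * N ! := by
  have hYN : Y.card ≤ N := by omega
  have hAN : A.card ≤ N := by simpa using A.card_le_univ
  have h1 : (Finset.univ.filter fun π : Equiv.Perm (Fin N) => ∀ x ∈ A, π x ∈ Y).card *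
      N ^ A.card ≤ Y.card ^ A.card * N ! := by
    calc _ ≤ (N - A.card)! * Y.card.descFactorial A.card * N ^ A.card :=
          Nat.mul_le_mul_right _ (card_perm_mapsTo_le A Y)
      _ ≤ (N - A.card)! * (Y.card ^ A.card * N.descFactorial A.card) := by
          rw [mul_assoc]
          exact Nat.mul_le_mul_left _ (descFactorial_mul_pow_le hYN _)
      _ = Y.card ^ A.card * N ! := by
          rw [← Nat.factorial_mul_descFactorial hAN]
          ring
  have h2 : ((Finset.univ.filter fun π : Equiv.Perm (Fin N) => ∀ x ∈ A, π x ∈ Y).card : ℝ) *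
      (N : ℝ) ^ A.card ≤ (Y.card : ℝ) ^ A.card * N ! := by exact_mod_cast h1
  have hN' : (0 : ℝ) < N := by exact_mod_cast hN
  have h3 : (Y.card : ℝ) ≤ 3 / 4 * N := by
    have : (4 * Y.card : ℝ) ≤ 3 * N := by exact_mod_cast hY
    linarith
  have h4 : (Y.card : ℝ) ^ A.card ≤ (3 / 4) ^ A.card * (N : ℝ) ^ A.card := by
    rw [← mul_pow]
    exact pow_le_pow_left₀ (Nat.cast_nonneg _) h3 _
  refine le_of_mul_le_mul_right ?_ (pow_pos hN' A.card)
  refine h2.trans ((mul_le_mul_of_nonneg_right h4 (Nat.cast_nonneg _)).trans_eq ?_)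
  ring

open scoped Nat in
/-- Some twenty permutations expand every set with at least a quarter of the points: the union bound
over the at most `4 ^ N` pairs `(A, Y)` succeeds since `4 * (3 / 4) ^ 5 < 1`. -/
theorem exists_expanding_perms {N : ℕ} (hN : 0 < N) :
    ∃ π : Fin 20 → Equiv.Perm (Fin N), ∀ A Y : Finset (Fin N), N ≤ 4 * A.card →
      4 * Y.card ≤ 3 * N → ∃ i, ∃ x ∈ A, π i x ∉ Y := by
  classical
  by_contra! hbad
  let T : Finset (Finset (Fin N) × Finset (Fin N)) :=
    Finset.univ.filter fun p => N ≤ 4 * p.1.card ∧ 4 * p.2.card ≤ 3 * N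
  let S : Finset (Fin N) × Finset (Fin N) → Finset (Equiv.Perm (Fin N)) := fun p =>
    Finset.univ.filter fun π => ∀ x ∈ p.1, π x ∈ p.2
  have hcov : (Finset.univ : Finset (Fin 20 → Equiv.Perm (Fin N))) ⊆
      T.biUnion fun p => Fintype.piFinset fun _ => S p := by
    intro π _
    obtain ⟨A, Y, hA, hY, h⟩ := hbad π
    rw [Finset.mem_biUnion]
    exact ⟨(A, Y), Finset.mem_filter.2 ⟨Finset.mem_univ _, hA, hY⟩, Fintype.mem_piFinset.2 fun i =>
      Finset.mem_filter.2 ⟨Finset.mem_univ _, h i⟩⟩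
  have h1 := (Finset.card_le_card hcov).trans Finset.card_biUnion_le
  rw [Finset.card_univ, Fintype.card_fun, Fintype.card_perm, Fintype.card_fin, Fintype.card_fin]
    at h1
  have h2 : ∀ p ∈ T, ((Fintype.piFinset fun _ : Fin 20 => S p).card : ℝ) ≤
      (3 / 4) ^ (5 * N) * (N ! : ℝ) ^ 20 := by
    intro p hp
    obtain ⟨hA, hY⟩ := (Finset.mem_filter.1 hp).2
    rw [Fintype.card_piFinset_const, Nat.cast_pow]
    refine (pow_le_pow_left₀ (Nat.cast_nonneg _) (card_perm_mapsTo_le_pow hN hY) 20).trans ?_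
    rw [mul_pow, ← pow_mul]
    refine mul_le_mul_of_nonneg_right ?_ (by positivity)
    exact pow_le_pow_of_le_one (by norm_num) (by norm_num) (by omega)
  have h3 : (T.card : ℝ) ≤ 4 ^ N := by
    have : T.card ≤ 4 ^ N := by
      refine T.card_le_univ.trans_eq ?_
      rw [Fintype.card_prod, Fintype.card_finset, Fintype.card_fin, ← mul_pow]
      norm_num
    exact_mod_cast this
  have h4 : ((N ! : ℝ)) ^ 20 ≤ 4 ^ N * ((3 / 4) ^ (5 * N) * (N ! : ℝ) ^ 20) := by
    calc ((N ! : ℝ)) ^ 20 ≤ ∑ p ∈ T, ((Fintype.piFinset fun _ : Fin 20 => S p).card : ℝ) := by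
          exact_mod_cast h1
      _ ≤ T.card • ((3 / 4) ^ (5 * N) * (N ! : ℝ) ^ 20) := Finset.sum_le_card_nsmul _ _ _ h2
      _ ≤ _ := by
          rw [nsmul_eq_mul]
          exact mul_le_mul_of_nonneg_right h3 (by positivity)
  have h5 : (4 : ℝ) ^ N * (3 / 4) ^ (5 * N) < 1 := by
    rw [pow_mul, ← mul_pow]
    exact pow_lt_one₀ (by norm_num) (by norm_num) hN.ne'
  have h6 : (0 : ℝ) < (N ! : ℝ) ^ 20 := by positivity
  rw [← mul_assoc] at h4
  nlinarith

/-- The permutation attached to a port: the ports `i < 20` carry the given permutations, and the port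
opposite to `i` carries the inverse of the permutation at `i`. -/
def portPerm {N : ℕ} (π : Fin 20 → Equiv.Perm (Fin N)) (i : ZMod 40) : Equiv.Perm (Fin N) :=
  if h : i.val < 20 then π ⟨i.val, h⟩
  else (π ⟨i.val - 20, by have := ZMod.val_lt i; omega⟩)⁻¹

theorem portPerm_add {N : ℕ} (π : Fin 20 → Equiv.Perm (Fin N)) (i : ZMod 40) :
    portPerm π (i + 20) = (portPerm π i)⁻¹ := by
  have hval : ∀ i : ZMod 40, (i + 20).val = if i.val < 20 then i.val + 20 else i.val - 20 := by
    decide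
  have hlt := ZMod.val_lt i
  by_cases h : i.val < 20
  · have h1 : (i + 20).val = i.val + 20 := by rw [hval, if_pos h]
    have h2 : ¬ (i + 20).val < 20 := by omega
    rw [portPerm, dif_neg h2, portPerm, dif_pos h]
    congr 3
    omega
  · have h1 : (i + 20).val = i.val - 20 := by rw [hval, if_neg h]
    have h2 : (i + 20).val < 20 := by omega
    rw [portPerm, dif_pos h2, portPerm, dif_neg h, inv_inv]
    congr 2

theorem portPerm_natCast {N : ℕ} (π : Fin 20 → Equiv.Perm (Fin N)) (i : Fin 20) :
    portPerm π ((i : ℕ) : ZMod 40) = π i := by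
  have h : (((i : ℕ) : ZMod 40)).val = i := ZMod.val_natCast_of_lt (by omega)
  rw [portPerm, dif_pos (by omega)]
  congr 1
  exact Fin.ext h

/-- The cubic graph obtained from the Schreier graph of twenty permutations by replacing each point
with a cycle through its forty ports, where port `i` of `x` is joined to the opposite port `i + 20` of
the image of `x` under the permutation at `i`. -/
def portGraph {N : ℕ} (π : Fin 20 → Equiv.Perm (Fin N)) : FinGraph where
  V := Fin N × ZMod 40
  graph :=
    { Adj := fun p q => (p.1 = q.1 ∧ (q.2 = p.2 + 1 ∨ p.2 = q.2 + 1)) ∨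
        (q.2 = p.2 + 20 ∧ q.1 = portPerm π p.2 p.1)
      symm := ⟨by
        have h40 : ∀ i : ZMod 40, i + 20 + 20 = i := by decide
        rintro ⟨x, i⟩ ⟨y, j⟩ (⟨h1, h2⟩ | ⟨h1, h2⟩)
        · exact Or.inl ⟨h1.symm, h2.symm⟩
        · simp only at h1 h2
          refine Or.inr ⟨?_, ?_⟩
          · rw [h1, h40]
          · rw [h1, h2, portPerm_add]
            exact ((portPerm π i).symm_apply_apply x).symm⟩
      loopless := ⟨by
        have h1 : ∀ i : ZMod 40, i ≠ i + 1 := by decide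
        have h20 : ∀ i : ZMod 40, i ≠ i + 20 := by decide
        rintro ⟨x, i⟩ (⟨-, h | h⟩ | ⟨h, -⟩)
        · exact h1 i h
        · exact h1 i h
        · exact h20 i h⟩ }

theorem portGraph_isCubic {N : ℕ} (π : Fin 20 → Equiv.Perm (Fin N)) : (portGraph π).IsCubic := by
  rintro ⟨x, i⟩
  have h1 : ∀ i : ZMod 40, i + 1 ≠ i - 1 := by decide
  have h2 : ∀ i : ZMod 40, i + 1 ≠ i + 20 := by decide
  have h3 : ∀ i : ZMod 40, i - 1 ≠ i + 20 := by decide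
  rw [Set.ncard_eq_three]
  refine ⟨(x, i + 1), (x, i - 1), (portPerm π i x, i + 20), fun h => h1 i (congrArg Prod.snd h),
    fun h => h2 i (congrArg Prod.snd h), fun h => h3 i (congrArg Prod.snd h), ?_⟩
  ext ⟨y, j⟩
  change ((x = y ∧ (j = i + 1 ∨ i = j + 1)) ∨ (j = i + 20 ∧ y = portPerm π i x)) ↔
    ((y, j) = (x, i + 1) ∨ (y, j) = (x, i - 1) ∨ (y, j) = (portPerm π i x, i + 20))
  rw [Prod.mk.injEq, Prod.mk.injEq, Prod.mk.injEq, eq_sub_iff_add_eq, eq_comm (a := x),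
    eq_comm (a := i)]
  tauto

theorem order_portGraph {N : ℕ} (π : Fin 20 → Equiv.Perm (Fin N)) :
    (portGraph π).order = 40 * N := by
  change Nat.card (Fin N × ZMod 40) = _
  rw [Nat.card_prod, Nat.card_fin, Nat.card_zmod, mul_comm]

/-- A small balanced separator misses all ports of all but few points. The components of the rest can
be grouped so that the points of the group number between a quarter and two thirds of all; by expansion
some permutation leads from the group to a further point whose ports are not separated. -/
theorem le_sepNumber_portGraph {N : ℕ} {π : Fin 20 → Equiv.Perm (Fin N)}
    (hπ : ∀ A Y : Finset (Fin N), N ≤ 4 * A.card → 4 * Y.card ≤ 3 * N →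
      ∃ i, ∃ x ∈ A, π i x ∉ Y) : N ≤ 12 * (portGraph π).sepNumber := by
  classical
  obtain ⟨X, hX, hXs⟩ := exists_isBalancedSeparator (portGraph π)
  by_contra! hlt
  change Set (Fin N × ZMod 40) at X
  replace hlt : 12 * X.ncard < N := hXs ▸ hlt
  let H := (portGraph π).graph.induce Xᶜ
  let D : Set (Fin N) := Prod.fst '' X
  have hD : D.ncard ≤ X.ncard := Set.ncard_image_le X.toFinite
  have hDX : ∀ x ∉ D, ∀ i, (x, i) ∉ X := fun x hx i h => hx ⟨_, h, rfl⟩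
  have hadj : ∀ {p q : Fin N × ZMod 40} (hp : p ∉ X) (hq : q ∉ X), (portGraph π).graph.Adj p q →
      H.connectedComponentMk ⟨p, hp⟩ = H.connectedComponentMk ⟨q, hq⟩ := by
    intro p q hp hq h
    exact SimpleGraph.ConnectedComponent.connectedComponentMk_eq_of_adj h
  have hport : ∀ x (hx : x ∉ D) (i : ZMod 40), H.connectedComponentMk ⟨(x, i), hDX x hx i⟩ =
      H.connectedComponentMk ⟨(x, 0), hDX x hx 0⟩ := by
    intro x hx i
    have key : ∀ n : ℕ, H.connectedComponentMk ⟨(x, (n : ZMod 40)), hDX x hx n⟩ =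
        H.connectedComponentMk ⟨(x, 0), hDX x hx 0⟩ := by
      intro n
      induction n with
      | zero => simp
      | succ n ih =>
        rw [← ih]
        refine hadj _ _ (Or.inl ⟨rfl, Or.inr ?_⟩)
        push_cast
        rfl
    have := key i.val
    simpa using this
  let w : Set H.ConnectedComponent → Set (Fin N) := fun T =>
    {x | ∃ hx : x ∉ D, H.connectedComponentMk ⟨(x, 0), hDX x hx 0⟩ ∈ T}
  have hsingle : ∀ t, 3 * (w {t}).ncard ≤ 2 * N := by
    intro t
    have h1 := hX t
    rw [order_portGraph] at h1
    have h2 : (w {t} ×ˢ (Set.univ : Set (ZMod 40))).ncard ≤ (Subtype.val '' t.supp).ncard := by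
      refine Set.ncard_le_ncard ?_
      rintro ⟨x, i⟩ ⟨⟨hx, ht⟩, -⟩
      exact ⟨⟨(x, i), hDX x hx i⟩, (hport x hx i).trans ht, rfl⟩
    rw [Set.ncard_prod, Set.ncard_univ, Nat.card_zmod,
      Set.ncard_image_of_injective t.supp Subtype.val_injective] at h2
    replace h1 : 3 * t.supp.ncard ≤ 2 * (40 * N) := h1
    omega
  have hDc : Dᶜ.ncard = N - D.ncard := by
    rw [Set.ncard_compl, Nat.card_fin]
  -- A union of as few components as possible that meets a quarter of the points does not meet more
  -- than two thirds of them.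
  have hfin : Finite H.ConnectedComponent := Quot.finite _
  obtain ⟨T, hT, hTmin⟩ := Set.exists_min_image {T | N ≤ 4 * (w T).ncard} Set.ncard (Set.toFinite _)
    ⟨Set.univ, by
      have : w Set.univ = Dᶜ := by
        ext x
        exact ⟨fun h => h.1, fun h => ⟨h, trivial⟩⟩
      rw [Set.mem_ofPred_eq, this]
      omega⟩
  have hT' : N ≤ 4 * (w T).ncard := hT
  have hdiff : ∀ t ∈ T, 4 * (w (T \ {t})).ncard < N := by
    intro t ht
    by_contra! h
    have h1 := hTmin _ h
    have h2 := Set.ncard_sdiff_singleton_lt_of_mem ht T.toFinite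
    omega
  have hupper : 3 * (w T).ncard ≤ 2 * N := by
    by_contra! h
    obtain ⟨x, hx, ht⟩ : (w T).Nonempty := by
      rw [← Set.ncard_pos]
      omega
    set t := H.connectedComponentMk ⟨(x, 0), hDX x hx 0⟩
    have h1 : (w T).ncard ≤ (w (T \ {t})).ncard + (w {t}).ncard := by
      refine le_trans (Set.ncard_le_ncard ?_) (Set.ncard_union_le _ _)
      rintro y ⟨hy, hyT⟩
      by_cases hyt : H.connectedComponentMk ⟨(y, 0), hDX y hy 0⟩ = t
      · exact Or.inr ⟨hy, hyt⟩
      · exact Or.inl ⟨hy, hyT, hyt⟩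
    have h2 := hsingle t
    have h3 := hdiff t ht
    obtain ⟨y, hy, hyT, hyt⟩ : (w (T \ {t})).Nonempty := by
      rw [← Set.ncard_pos]
      omega
    have h4 := hdiff _ hyT
    have h5 : (w {t}).ncard ≤ (w (T \ {H.connectedComponentMk ⟨(y, 0), hDX y hy 0⟩})).ncard := by
      refine Set.ncard_le_ncard ?_
      rintro z ⟨hz, hzt⟩
      refine ⟨hz, ?_, ?_⟩
      · rw [Set.mem_singleton_iff.1 hzt]
        exact ht
      · rw [Set.mem_singleton_iff.1 hzt]
        exact fun h => hyt h.symm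
    omega
  have hcardA : (w T).toFinset.card = (w T).ncard := (Set.ncard_eq_toFinset_card' _).symm
  have hcardD : D.toFinset.card = D.ncard := (Set.ncard_eq_toFinset_card' _).symm
  have hcardY := Finset.card_union_le (w T).toFinset D.toFinset
  obtain ⟨i, x, hxA, hxY⟩ := hπ (w T).toFinset ((w T).toFinset ∪ D.toFinset) (by omega) (by omega)
  rw [Finset.mem_union, Set.mem_toFinset, Set.mem_toFinset, not_or] at hxY
  obtain ⟨hx, hxT⟩ := Set.mem_toFinset.1 hxA
  refine hxY.1 ⟨hxY.2, ?_⟩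
  have h := hadj (hDX x hx ((i : ℕ) : ZMod 40)) (hDX _ hxY.2 (((i : ℕ) : ZMod 40) + 20))
    (Or.inr ⟨rfl, by rw [portPerm_natCast]⟩)
  rw [hport x hx, hport _ hxY.2] at h
  rwa [← h]

/-- Cubic graphs whose separation number is linear in the order, for all multiples of forty. -/
theorem exists_cubic_le_sepNumber {N : ℕ} (hN : 0 < N) :
    ∃ G : FinGraph, G.IsCubic ∧ G.order = 40 * N ∧ N ≤ 12 * G.sepNumber := by
  obtain ⟨π, hπ⟩ := exists_expanding_perms hN
  exact ⟨portGraph π, portGraph_isCubic π, order_portGraph π, le_sepNumber_portGraph hπ⟩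

/-! ### Growth rates -/

theorem isHereditary_cubicSubdivisionClass (ε : ℝ) : IsHereditary (cubicSubdivisionClass ε) := by
  rintro H ⟨G, hG, ⟨φ⟩⟩ H' ⟨ψ⟩
  exact ⟨G, hG, ⟨φ.comp ψ⟩⟩

/-- Either `G` has at most `n ^ (1 - ε)` vertices, or its edges are subdivided at least `n ^ ε` times
and a graph with `n` vertices contains at most `n ^ (1 - ε)` of them completely. -/
theorem sepNumber_le_of_mem_cubicSubdivisionClass {ε : ℝ} (hε0 : 0 < ε) (hε1 : ε < 1)
    {L : FinGraph} (hL : L ∈ cubicSubdivisionClass ε) {n : ℕ} (hn : 0 < n) (hLn : L.order ≤ n) :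
    (L.sepNumber : ℝ) ≤ 4 * (n : ℝ) ^ (1 - ε) := by
  obtain ⟨G, -, ⟨φ⟩⟩ := hL
  obtain ⟨f, hf, hs⟩ := exists_sepNumber_le_of_induced φ
  set k := ⌈(G.order : ℝ) ^ (ε / (1 - ε))⌉₊
  have hn0 : (0 : ℝ) < n := by exact_mod_cast hn
  have hn1 : (1 : ℝ) ≤ n := by exact_mod_cast hn
  have h1ε : (0 : ℝ) < 1 - ε := by linarith
  have hone : (1 : ℝ) ≤ (n : ℝ) ^ (1 - ε) := Real.one_le_rpow hn1 h1ε.le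
  have hs' : (L.sepNumber : ℝ) ≤ min (G.order : ℝ) (2 * f) + 2 := by exact_mod_cast hs
  suffices hmin : min (G.order : ℝ) (2 * f) ≤ 2 * (n : ℝ) ^ (1 - ε) by linarith
  rcases le_total (G.order : ℝ) ((n : ℝ) ^ (1 - ε)) with h | h
  · exact (min_le_left _ _).trans (by linarith)
  · refine (min_le_right _ _).trans (mul_le_mul_of_nonneg_left ?_ (by norm_num))
    have hk : (n : ℝ) ^ ε ≤ k := by
      calc (n : ℝ) ^ ε = ((n : ℝ) ^ (1 - ε)) ^ (ε / (1 - ε)) := by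
            rw [← Real.rpow_mul hn0.le, mul_div_cancel₀ _ h1ε.ne']
        _ ≤ (G.order : ℝ) ^ (ε / (1 - ε)) :=
            Real.rpow_le_rpow (by positivity) h (by positivity)
        _ ≤ k := Nat.le_ceil _
    have hfk : (f : ℝ) * k ≤ n := by exact_mod_cast hf.trans hLn
    rw [Real.rpow_sub hn0, Real.rpow_one, le_div_iff₀ (Real.rpow_pos_of_pos hn0 _)]
    exact (mul_le_mul_of_nonneg_left hk (Nat.cast_nonneg _)).trans hfk

theorem IsCubic.order_epsSubdivision_le {ε : ℝ} (hε0 : 0 < ε) (hε1 : ε < 1) {G : FinGraph}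
    (hG : G.IsCubic) (hpos : 0 < G.order) :
    ((G.epsSubdivision ε).order : ℝ) ≤ 4 * (G.order : ℝ) ^ (1 / (1 - ε)) := by
  have h1ε : (0 : ℝ) < 1 - ε := by linarith
  have hm0 : (0 : ℝ) < G.order := by exact_mod_cast hpos
  have hm1 : (1 : ℝ) ≤ G.order := by exact_mod_cast hpos
  have hpow : (G.order : ℝ) ^ (1 / (1 - ε)) = G.order * (G.order : ℝ) ^ (ε / (1 - ε)) := by
    rw [show 1 / (1 - ε) = 1 + ε / (1 - ε) by field_simp; ring, Real.rpow_add hm0, Real.rpow_one]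
  have hone : (1 : ℝ) ≤ (G.order : ℝ) ^ (ε / (1 - ε)) := Real.one_le_rpow hm1 (by positivity)
  have hk : (⌈(G.order : ℝ) ^ (ε / (1 - ε))⌉₊ : ℝ) ≤ 2 * (G.order : ℝ) ^ (ε / (1 - ε)) := by
    have := (Nat.ceil_lt_add_one (by positivity : 0 ≤ (G.order : ℝ) ^ (ε / (1 - ε)))).le
    linarith
  have hE : 2 * (G.graph.edgeSet.ncard : ℝ) = 3 * G.order := by
    exact_mod_cast hG.two_mul_ncard_edgeSet
  rw [epsSubdivision, order_subdivide, hpow]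
  push_cast
  have h1 : (G.graph.edgeSet.ncard : ℝ) * (⌈(G.order : ℝ) ^ (ε / (1 - ε))⌉₊ : ℝ) ≤
      G.graph.edgeSet.ncard * (2 * (G.order : ℝ) ^ (ε / (1 - ε))) :=
    mul_le_mul_of_nonneg_left hk (Nat.cast_nonneg _)
  have h2 : (G.graph.edgeSet.ncard : ℝ) * (2 * (G.order : ℝ) ^ (ε / (1 - ε))) =
      3 * (G.order * (G.order : ℝ) ^ (ε / (1 - ε))) := by
    rw [← mul_assoc, mul_comm _ (2 : ℝ), hE, mul_assoc]
  have h3 := mul_le_mul_of_nonneg_left hone hm0.le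
  linarith

theorem le_classSep_cubicSubdivisionClass {ε : ℝ} (hε0 : 0 < ε) (hε1 : ε < 1) {n : ℕ}
    (hn : 320 ≤ (n : ℝ) ^ (1 - ε)) :
    (n : ℝ) ^ (1 - ε) ≤ 7680 * classSep (cubicSubdivisionClass ε) n := by
  have h1ε : (0 : ℝ) < 1 - ε := by linarith
  have hn4 : (0 : ℝ) ≤ (n : ℝ) / 4 := by positivity
  set x : ℝ := ((n : ℝ) / 4) ^ (1 - ε) with hx
  have hxn : (n : ℝ) ^ (1 - ε) ≤ 4 * x := by
    have h4 : (4 : ℝ) ^ (1 - ε) ≤ 4 := by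
      calc (4 : ℝ) ^ (1 - ε) ≤ 4 ^ (1 : ℝ) :=
            Real.rpow_le_rpow_of_exponent_le (by norm_num) (by linarith)
        _ = 4 := Real.rpow_one _
    have h0 : (0 : ℝ) ≤ x := Real.rpow_nonneg hn4 _
    calc (n : ℝ) ^ (1 - ε) = (4 * ((n : ℝ) / 4)) ^ (1 - ε) := by
          rw [mul_div_cancel₀ _ (by norm_num)]
      _ = 4 ^ (1 - ε) * x := Real.mul_rpow (by norm_num) hn4
      _ ≤ 4 * x := mul_le_mul_of_nonneg_right h4 h0
  -- With `x = (n / 4) ^ (1 - ε)`, a cubic graph of order at most `x` has a subdivision with at most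
  -- `n` vertices.
  obtain ⟨N, hN⟩ : ∃ N : ℕ, N = ⌊x / 40⌋₊ := ⟨_, rfl⟩
  have hNle : (N : ℝ) ≤ x / 40 := hN ▸ Nat.floor_le (by linarith)
  have hNge : x / 40 < N + 1 := hN ▸ Nat.lt_floor_add_one _
  have hN0 : 0 < N := by
    have : (0 : ℝ) < N := by linarith
    exact_mod_cast this
  obtain ⟨G, hG, hord, hsep⟩ := exists_cubic_le_sepNumber hN0
  have horder : ((G.epsSubdivision ε).order : ℝ) ≤ n := by
    refine (hG.order_epsSubdivision_le hε0 hε1 (by omega)).trans ?_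
    have h1 : (G.order : ℝ) ≤ x := by
      rw [hord]
      push_cast
      linarith
    have h2 : (G.order : ℝ) ^ (1 / (1 - ε)) ≤ (n : ℝ) / 4 := by
      calc (G.order : ℝ) ^ (1 / (1 - ε)) ≤ x ^ (1 / (1 - ε)) :=
            Real.rpow_le_rpow (Nat.cast_nonneg _) h1 (by positivity)
        _ = (n : ℝ) / 4 := by
            rw [hx, ← Real.rpow_mul hn4, mul_one_div_cancel h1ε.ne', Real.rpow_one]
    linarith
  have hmem : G.epsSubdivision ε ∈ cubicSubdivisionClass ε :=
    ⟨G, hG, ⟨SimpleGraph.Embedding.refl⟩⟩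
  have h1 : (G.epsSubdivision ε).sepNumber ≤ classSep (cubicSubdivisionClass ε) n :=
    le_classSep hmem (by exact_mod_cast horder)
  have h2 : G.sepNumber ≤ 2 * (G.epsSubdivision ε).sepNumber := hG.sepNumber_le_two_mul _
  have h3 : N ≤ 24 * classSep (cubicSubdivisionClass ε) n := by omega
  have h4 : (N : ℝ) ≤ 24 * classSep (cubicSubdivisionClass ε) n := by exact_mod_cast h3
  linarith

theorem sepIsTheta_cubicSubdivisionClass {ε : ℝ} (hε0 : 0 < ε) (hε1 : ε < 1) :
    SepIsTheta (cubicSubdivisionClass ε) (1 - ε) := by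
  constructor
  · refine IsBigO.of_bound 4 ?_
    filter_upwards [eventually_gt_atTop 0] with n hn
    have h0 : (0 : ℝ) ≤ 4 * (n : ℝ) ^ (1 - ε) := by positivity
    have h : classSep (cubicSubdivisionClass ε) n ≤ ⌊4 * (n : ℝ) ^ (1 - ε)⌋₊ :=
      classSep_le fun L hL hLn =>
        Nat.le_floor (sepNumber_le_of_mem_cubicSubdivisionClass hε0 hε1 hL hn hLn)
    rw [Real.norm_of_nonneg (Nat.cast_nonneg _), Real.norm_of_nonneg (by positivity)]
    exact (Nat.le_floor_iff h0).1 h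
  · refine IsBigO.of_bound 7680 ?_
    have htend : Tendsto (fun n : ℕ => (n : ℝ) ^ (1 - ε)) atTop atTop :=
      (tendsto_rpow_atTop (by linarith)).comp tendsto_natCast_atTop_atTop
    filter_upwards [htend.eventually_ge_atTop 320] with n hn
    rw [Real.norm_of_nonneg (Nat.cast_nonneg _), Real.norm_of_nonneg (by positivity)]
    exact le_classSep_cubicSubdivisionClass hε0 hε1 hn

theorem nablaIsBigO_cubicSubdivisionClass {ε : ℝ} (hε0 : 0 < ε) (hε1 : ε < 1) :
    NablaIsBigO (cubicSubdivisionClass ε) (1 / (2 * ε) - 1 / 2) := by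
  have h1ε : (0 : ℝ) < 1 - ε := by linarith
  set β : ℝ := 1 / (2 * ε) - 1 / 2 with hβ
  have hβ' : β = (1 - ε) / (2 * ε) := by
    rw [hβ]
    field_simp
  have hβ0 : 0 ≤ β := by
    rw [hβ']
    positivity
  refine ⟨5 + 2 * 2 ^ β, ?_⟩
  filter_upwards [eventually_ge_atTop 1] with r hr
  have hr1 : (1 : ℝ) ≤ r := by exact_mod_cast hr
  have hone : (1 : ℝ) ≤ (r : ℝ) ^ β := Real.one_le_rpow hr1 hβ0
  refine iSup₂_le ?_
  rintro L ⟨G, hG, ⟨φ⟩⟩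
  have hG3 : ∀ v, (G.graph.neighborSet v).ncard ≤ 3 := fun v => (hG v).le
  rcases le_or_gt (2 * r) ⌈(G.order : ℝ) ^ (ε / (1 - ε))⌉₊ with h | h
  · refine (nabla_le_of_subdivide_of_le φ hG3 h).trans (ENNReal.ofReal_le_ofReal ?_)
    have h2 : (0 : ℝ) ≤ 2 * 2 ^ β := by positivity
    nlinarith
  · refine (nabla_le_of_subdivide φ hG3 r).trans (ENNReal.ofReal_le_ofReal ?_)
    have h1 : (G.order : ℝ) ^ (ε / (1 - ε)) ≤ 2 * r := by
      refine (Nat.le_ceil _).trans ?_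
      exact_mod_cast h.le
    have h2 : √(G.order : ℝ) ≤ 2 ^ β * (r : ℝ) ^ β := by
      calc √(G.order : ℝ) = ((G.order : ℝ) ^ (ε / (1 - ε))) ^ β := by
            rw [← Real.rpow_mul (Nat.cast_nonneg _), Real.sqrt_eq_rpow, hβ']
            congr 1
            field_simp
        _ ≤ (2 * r) ^ β := Real.rpow_le_rpow (by positivity) h1 hβ0
        _ = _ := Real.mul_rpow (by norm_num) (by positivity)
    nlinarith

theorem le_of_nablaIsOmega_of_nablaIsBigO {𝒢 : Set FinGraph} {b β : ℝ} (h1 : NablaIsOmega 𝒢 b)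
    (h2 : NablaIsBigO 𝒢 β) : b ≤ β := by
  obtain ⟨c, hc, h1⟩ := h1
  obtain ⟨C, h2⟩ := h2
  by_contra! hlt
  have htend : Tendsto (fun n : ℕ => (n : ℝ) ^ (b - β)) atTop atTop :=
    (tendsto_rpow_atTop (by linarith)).comp tendsto_natCast_atTop_atTop
  obtain ⟨r, h1, h2, h3, hr⟩ := (h1.and (h2.and
    ((htend.eventually_gt_atTop (C / c)).and (eventually_gt_atTop 0)))).exists
  have hr0 : (0 : ℝ) < r := by exact_mod_cast hr
  have h4 := (ENNReal.ofReal_le_ofReal_iff' (p := c * (r : ℝ) ^ b)).1 (h1.trans h2)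
  have h5 : 0 < c * (r : ℝ) ^ b := mul_pos hc (Real.rpow_pos_of_pos hr0 _)
  have h6 := h4.resolve_right (not_le.2 h5)
  rw [div_lt_iff₀ hc, Real.rpow_sub hr0, div_mul_eq_mul_div,
    lt_div_iff₀ (Real.rpow_pos_of_pos hr0 _)] at h3
  linarith

theorem bExponent_le {ε β : ℝ} {𝒢 : Set FinGraph} (hher : IsHereditary 𝒢)
    (hsep : SepIsTheta 𝒢 (1 - ε)) (hnabla : NablaIsBigO 𝒢 β) : bExponent ε ≤ (β : EReal) := by
  refine sSup_le ?_
  rintro _ ⟨b, rfl, hb⟩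
  exact EReal.coe_le_coe_iff.2 (le_of_nablaIsOmega_of_nablaIsBigO (hb 𝒢 hher hsep) hnabla)

/-! ### Linear forests -/

/-- The graph with two adjacent vertices. -/
def singleEdge : FinGraph where
  V := Bool
  graph := ⊤

/-- The class of linear forests, that is, of induced subgraphs of paths with at least two
vertices. -/
def linearForests : Set FinGraph := {H | ∃ k, IsInducedSubgraph H (singleEdge.subdivide k)}

theorem order_singleEdge : singleEdge.order = 2 := by
  change Nat.card Bool = 2
  simp

theorem isHereditary_linearForests : IsHereditary linearForests := by
  rintro H ⟨k, ⟨φ⟩⟩ H' ⟨ψ⟩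
  exact ⟨k, ⟨φ.comp ψ⟩⟩

theorem one_le_classSep_linearForests {n : ℕ} (hn : 1 ≤ n) : 1 ≤ classSep linearForests n := by
  let K : FinGraph := { V := Unit, graph := ⊥ }
  have hKord : K.order = 1 := by
    change Nat.card Unit = 1
    simp
  have hK : K ∈ linearForests := by
    refine ⟨0, ⟨⟨⟨fun _ => Sum.inl true, fun _ _ _ => rfl⟩, ?_⟩⟩⟩
    intro x y
    exact iff_of_false (SimpleGraph.irrefl _) not_false
  refine le_trans ?_ (le_classSep hK (hKord.trans_le hn))
  by_contra! h
  obtain ⟨X, hX, hXs⟩ := exists_isBalancedSeparator K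
  have hX0 : X = ∅ := by
    rw [← Set.ncard_eq_zero]
    omega
  have h1 := hX ((K.graph.induce Xᶜ).connectedComponentMk ⟨(), by simp [hX0]⟩)
  have h2 : 0 < ((K.graph.induce Xᶜ).connectedComponentMk ⟨(), by simp [hX0]⟩).supp.ncard :=
    (Set.ncard_pos).2 (SimpleGraph.ConnectedComponent.nonempty_supp _)
  rw [hKord] at h1
  omega

theorem sepIsTheta_linearForests : SepIsTheta linearForests 0 := by
  constructor
  · refine IsBigO.of_bound 4 (Eventually.of_forall fun n => ?_)
    have h : classSep linearForests n ≤ 4 := by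
      refine classSep_le ?_
      rintro L ⟨k, ⟨φ⟩⟩ -
      obtain ⟨f, -, hs⟩ := exists_sepNumber_le_of_induced φ
      rw [order_singleEdge] at hs
      omega
    rw [Real.norm_of_nonneg (Nat.cast_nonneg _), Real.rpow_zero, norm_one, mul_one]
    exact_mod_cast h
  · refine IsBigO.of_bound 1 ?_
    filter_upwards [eventually_ge_atTop 1] with n hn
    rw [Real.norm_of_nonneg (Nat.cast_nonneg _), Real.rpow_zero, norm_one, one_mul]
    exact_mod_cast one_le_classSep_linearForests hn

theorem nablaIsBigO_linearForests : NablaIsBigO linearForests 0 := by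
  refine ⟨5 + 2 * √2, Eventually.of_forall fun r => ?_⟩
  rw [Real.rpow_zero, mul_one]
  refine iSup₂_le ?_
  rintro L ⟨k, ⟨φ⟩⟩
  have h := nabla_le_of_subdivide φ (fun v => (Set.ncard_le_card _).trans
    (order_singleEdge.le.trans (by norm_num))) r
  rwa [order_singleEdge, Nat.cast_ofNat] at h

end FinGraph

theorem mainTheorem1 (ε : ℝ) (hε0 : 0 < ε) (hε1 : ε ≤ 1) :
    FinGraph.bExponent ε ≤ ((1 / (2 * ε) - 1 / 2 : ℝ) : EReal) ∧
    (ε < 1 →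
      FinGraph.IsHereditary (FinGraph.cubicSubdivisionClass ε) ∧
      FinGraph.SepIsTheta (FinGraph.cubicSubdivisionClass ε) (1 - ε) ∧
      FinGraph.NablaIsBigO (FinGraph.cubicSubdivisionClass ε) (1 / (2 * ε) - 1 / 2)) := by
  have hcubic : ε < 1 → FinGraph.IsHereditary (FinGraph.cubicSubdivisionClass ε) ∧
      FinGraph.SepIsTheta (FinGraph.cubicSubdivisionClass ε) (1 - ε) ∧
      FinGraph.NablaIsBigO (FinGraph.cubicSubdivisionClass ε) (1 / (2 * ε) - 1 / 2) := fun h =>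
    ⟨FinGraph.isHereditary_cubicSubdivisionClass ε,
      FinGraph.sepIsTheta_cubicSubdivisionClass hε0 h,
      FinGraph.nablaIsBigO_cubicSubdivisionClass hε0 h⟩
  refine ⟨?_, hcubic⟩
  rcases hε1.lt_or_eq with h | rfl
  · exact FinGraph.bExponent_le (hcubic h).1 (hcubic h).2.1 (hcubic h).2.2
  · refine FinGraph.bExponent_le FinGraph.isHereditary_linearForests ?_ ?_
    · rw [sub_self]
      exact FinGraph.sepIsTheta_linearForests
    · rw [show (1 / (2 * 1) - 1 / 2 : ℝ) = 0 by norm_num]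
      exact FinGraph.nablaIsBigO_linearForests
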